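/- Let $S\subseteq C^*(S)$ be a separable operator system, that is, a norm-separable self-adjoint linear subspace, containing the unit, of a unital $C^*$-algebra $C^*(S)$ that is generated by $S$ as a $C^*$-algebra. Let $H_0$ be a separable complex Hilbert space and let $\phi_0:S\to\mathcal B(H_0)$ be a unital completely positive (UCP) map. Then there are a separable Hilbert space $H\supseteq H_0$ and a UCP map $\phi:S\to\mathcal B(H)$ such that (1) $\phi$ is a dilation of $\phi_0$: $P_{H_0}\phi(x)\restriction_{H_0}=\phi_0(x)$ for all $x\in S$; (2) $\phi$ has the unique extension property: $\phi$ has exactly one completely positive extension $\tilde\phi:C^*(S)\to\mathcal B(H)$, and $\tilde\phi$ is a representation of $C^*(S)$ on $H$; (3) $\phi$ is maximal: for every Hilbert space $K\supseteq H$ and every UCP map $\phi':S\to\mathcal B(K)$ with $P_H\phi'(x)\restriction_H=\phi(x)$ for all $x\in S$, one has $\phi'=\phi\oplus\psi$ for some UCP map $\psi:S\to\mathcal B(K\ominus H)$. (Inclusions of Hilbert spaces are understood up to isometric embedding.) -/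

import Mathlib

open scoped CStarAlgebra InnerProductSpace

universe u v w

/-- An operator system `S ⊆ C*(S)`: a self-adjoint linear subspace of a unital C⋆-algebra `A` that
contains the unit and generates `A` as a C⋆-algebra, so that `A = C*(S)`. -/
structure OperatorSystem (A : Type u) [CStarAlgebra A] extends Submodule ℂ A where
  one_mem' : (1 : A) ∈ carrier
  star_mem' : ∀ {a : A}, a ∈ carrier → star a ∈ carrier
  generates' : (StarAlgebra.adjoin ℂ carrier).topologicalClosure = ⊤

namespace OperatorSystem

variable {A : Type u} [CStarAlgebra A]

/-- Linear maps `S → B(H)`. -/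
abbrev OpMap (S : OperatorSystem A) (H : Type v) [NormedAddCommGroup H] [InnerProductSpace ℂ H] :
    Type (max u v) :=
  S.toSubmodule →ₗ[ℂ] (H →L[ℂ] H)

/-- Dilation: with `H₀` regarded as a subspace of `H` by means of the isometry `V`, the compression
of `φ` to `H₀` is `φ₀`, that is, `φ₀ x = V* φ(x) V` for all `x ∈ S`. -/
def IsDilation {S : OperatorSystem A}
    {H₀ : Type v} [NormedAddCommGroup H₀] [InnerProductSpace ℂ H₀] [CompleteSpace H₀]
    {H : Type w} [NormedAddCommGroup H] [InnerProductSpace ℂ H] [CompleteSpace H]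
    (φ₀ : S.OpMap H₀) (V : H₀ →ₗᵢ[ℂ] H) (φ : S.OpMap H) : Prop :=
  ∀ x, φ₀ x = ContinuousLinearMap.adjoint V.toContinuousLinearMap ∘L φ x ∘L
    V.toContinuousLinearMap

variable [PartialOrder A] [StarOrderedRing A] {S : OperatorSystem A}
  {H : Type v} [NormedAddCommGroup H] [InnerProductSpace ℂ H] [CompleteSpace H]

/-- `φ : S → B(H)` is completely positive: every matrix over `S` that is positive in `Mₙ(A)` is
mapped entrywise to a positive element of `Mₙ(B(H))`. -/
def IsCompletelyPositive (φ : S.OpMap H) : Prop :=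
  ∀ (n : ℕ) (M : CStarMatrix (Fin n) (Fin n) S.toSubmodule),
    0 ≤ M.map (Subtype.val : S.toSubmodule → A) → 0 ≤ M.map φ

/-- Unital completely positive maps. -/
structure IsUCP (φ : S.OpMap H) : Prop where
  map_one : φ ⟨1, S.one_mem'⟩ = 1
  completelyPositive : IsCompletelyPositive φ

/-- The completely positive map `ψ : C*(S) → B(H)` extends `φ : S → B(H)`. -/
def IsCPExtension (φ : S.OpMap H) (ψ : A →CP (H →L[ℂ] H)) : Prop :=
  ∀ x : S.toSubmodule, ψ (x : A) = φ x

/-- The unique extension property: `φ` has a unique completely positive extension to `C*(S)`, and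
that extension is a representation. -/
structure HasUniqueExtensionProperty (φ : S.OpMap H) : Prop where
  existsUnique_extension : ∃! ψ : A →CP (H →L[ℂ] H), IsCPExtension φ ψ
  representation : ∀ ψ : A →CP (H →L[ℂ] H), IsCPExtension φ ψ →
    ∃ π : A →⋆ₐ[ℂ] (H →L[ℂ] H), ∀ a, ψ a = π a

/-- `φ` is maximal: every UCP dilation `φ'` of `φ`, on a Hilbert space `K` that contains `H` by means
of an isometry `V`, is a direct sum `φ ⊕ ψ` for a UCP map `ψ` acting on the orthogonal complement
of `H` in `K`. -/
def IsMaximal (φ : S.OpMap H) : Prop :=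
  ∀ (K : Type w) [NormedAddCommGroup K] [InnerProductSpace ℂ K] [CompleteSpace K]
    (V : H →ₗᵢ[ℂ] K) (φ' : S.OpMap K), IsUCP φ' → IsDilation φ V φ' →
    ∃ ψ : S.OpMap (LinearMap.range V.toLinearMap)ᗮ, IsUCP ψ ∧
      ∀ (x : S.toSubmodule) (ξ : H) (η : (LinearMap.range V.toLinearMap)ᗮ),
        φ' x (V ξ + (η : K)) = V (φ x ξ) + (ψ x η : K)

end OperatorSystem

/-!
A dilation `ψ` of `φ` with isometry `V` satisfies `‖φ x ξ‖ ≤ ‖ψ x (V ξ)‖`, and equality forces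
`ψ x (V ξ) = V (φ x ξ)`. The norms `‖ψ x (V ξ)‖` are bounded by `‖x‖ ‖ξ‖` and increase along the
dilation order, in which increasing sequences have upper bounds (weak limits on the inductive limit
of the Hilbert spaces). By separability countably many pairs `(x, ξ)` decide everything, so some
separable dilation of `φ` can no longer increase these norms; iterating this step, the limit is a
separable dilation whose own dilations all leave its space invariant.

For such a map, invariance passes to orthogonal complements, which is maximality. It also gives the
unique extension property: in the Stinespring representation of a completely positive extension, the
space is invariant under `S`, hence under `C*(S)`, so that the extension is multiplicative, and
`⋆`-homomorphisms are determined on the generators. The theorems of Arveson and Stinespring come in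
one stroke from the M. Riesz extension theorem, applied to the finitely supported `A`-valued kernels
on the Hilbert space, and the GNS construction.
-/

section Positivity

open scoped ComplexOrder

section NonUnital

variable {B : Type*} [NonUnitalCStarAlgebra B] [PartialOrder B] [StarOrderedRing B]

lemma exists_eq_star_mul_self_of_nonneg {a : B} (ha : 0 ≤ a) : ∃ c, a = star c * c :=
  CStarAlgebra.nonneg_iff_eq_star_mul_self.mp ha

lemma nonneg_of_forall_star_mul_mul_eq_zero {a : B} (ha : IsSelfAdjoint a)
    (h : ∀ c, star c * a * c ≤ 0 → star c * a * c = 0) : 0 ≤ a := by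
  have hnonneg : 0 ≤ a⁻ := CFC.negPart_nonneg a
  have hstar : star a⁻ = a⁻ := hnonneg.isSelfAdjoint
  have hconj : star a⁻ * a * a⁻ = -(star a⁻ * a⁻ * a⁻) := by
    have : a⁻ * a = -(a⁻ * a⁻) := by
      nth_rewrite 2 [← CFC.posPart_sub_negPart a ha]
      rw [mul_sub, CFC.negPart_mul_posPart, zero_sub]
    rw [hstar, this, neg_mul]
  have hcube : star a⁻ * a⁻ * a⁻ = 0 := by
    rw [← neg_eq_zero, ← hconj]
    exact h _ (hconj.trans_le (neg_nonpos.mpr (star_left_conjugate_nonneg hnonneg a⁻)))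
  have hsq : a⁻ * a⁻ = 0 := by
    rw [← CStarRing.star_mul_self_eq_zero_iff, star_mul, hstar, ← mul_assoc]
    nth_rewrite 1 [← hstar]
    rw [hcube, zero_mul]
  refine (CFC.negPart_eq_zero_iff a ha).mp ?_
  rwa [← CStarRing.star_mul_self_eq_zero_iff, hstar]

end NonUnital

variable {n : Type*} [Fintype n] {A : Type*} [CStarAlgebra A]

/-- The quadratic form `b ↦ ∑ i j, (b i)⋆ (M i j) (b j)` of a matrix `M` over a C⋆-algebra, as a
linear function of `M`. -/
def matrixQuadForm (b : n → A) : CStarMatrix n n A →ₗ[ℂ] A where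
  toFun M := ∑ i, ∑ j, star (b i) * M i j * b j
  map_add' M N := by simp [mul_add, add_mul, Finset.sum_add_distrib]
  map_smul' c M := by simp [Finset.smul_sum]

lemma matrixQuadForm_apply (b : n → A) (M : CStarMatrix n n A) :
    matrixQuadForm b M = ∑ i, ∑ j, star (b i) * M i j * b j := rfl

lemma star_mul_mul_apply_self (M N : CStarMatrix n n A) (k : n) :
    (star N * M * N) k k = matrixQuadForm (fun i => N i k) M := by
  simp only [matrixQuadForm_apply, CStarMatrix.mul_apply, Finset.sum_mul, CStarMatrix.star_apply]
  rw [Finset.sum_comm]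

lemma matrixQuadForm_star (b : n → A) (M : CStarMatrix n n A) :
    matrixQuadForm b (star M) = star (matrixQuadForm b M) := by
  simp only [matrixQuadForm_apply, star_sum, star_mul, star_star, CStarMatrix.star_apply, mul_assoc]
  rw [Finset.sum_comm]

lemma matrixQuadForm_star_mul_self (b : n → A) (N : CStarMatrix n n A) :
    matrixQuadForm b (star N * N) = ∑ k, star (∑ i, N k i * b i) * ∑ i, N k i * b i := by
  simp only [matrixQuadForm_apply, CStarMatrix.mul_apply, CStarMatrix.star_apply, star_sum,
    star_mul, Finset.mul_sum, Finset.sum_mul, mul_assoc]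
  rw [Finset.sum_comm_cycle]
  exact Finset.sum_congr rfl fun k _ => Finset.sum_comm

variable [PartialOrder A] [StarOrderedRing A]

lemma cstarMatrix_eq_zero_of_nonneg_of_diag_nonpos {M : CStarMatrix n n A} (hM : 0 ≤ M)
    (h : ∀ k, M k k ≤ 0) : M = 0 := by
  obtain ⟨N, rfl⟩ := exists_eq_star_mul_self_of_nonneg hM
  suffices hN : N = 0 by rw [hN, mul_zero]
  ext i k
  have hcol : ∑ i, star (N i k) * N i k = 0 := by
    refine le_antisymm ?_ (Finset.sum_nonneg fun _ _ => star_mul_self_nonneg _)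
    simpa only [CStarMatrix.mul_apply, CStarMatrix.star_apply] using h k
  have hik := (Finset.sum_eq_zero_iff_of_nonneg fun i _ => star_mul_self_nonneg (N i k)).mp hcol
    i (Finset.mem_univ i)
  simpa only [CStarMatrix.zero_apply] using (CStarRing.star_mul_self_eq_zero_iff (N i k)).mp hik

lemma cstarMatrix_nonneg_of_isSelfAdjoint {M : CStarMatrix n n A} (hM : IsSelfAdjoint M)
    (h : ∀ b, 0 ≤ matrixQuadForm b M) : 0 ≤ M := by
  refine nonneg_of_forall_star_mul_mul_eq_zero hM fun N hN => ?_
  rw [← neg_eq_zero]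
  refine cstarMatrix_eq_zero_of_nonneg_of_diag_nonpos (neg_nonneg.mpr hN) fun k => ?_
  rw [CStarMatrix.neg_apply, star_mul_mul_apply_self, Left.neg_nonpos_iff]
  exact h _

lemma cstarMatrix_isSelfAdjoint_of_matrixQuadForm {M : CStarMatrix n n A}
    (h : ∀ b, IsSelfAdjoint (matrixQuadForm b M)) : IsSelfAdjoint M := by
  have eq_zero (P : CStarMatrix n n A) (hP : IsSelfAdjoint P) (h0 : ∀ b, matrixQuadForm b P = 0) :
      P = 0 :=
    le_antisymm
      (neg_nonneg.mp <| cstarMatrix_nonneg_of_isSelfAdjoint hP.neg fun b => by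
        rw [map_neg, h0, neg_zero])
      (cstarMatrix_nonneg_of_isSelfAdjoint hP fun b => (h0 b).ge)
  have hskew : Complex.I • (M - star M) = 0 := by
    refine eq_zero _ ?_ fun b => ?_
    · rw [isSelfAdjoint_iff, star_smul, Complex.star_def, Complex.conj_I, star_sub, star_star,
        neg_smul, ← smul_neg, neg_sub]
    · rw [map_smul, map_sub, matrixQuadForm_star, (h b).star_eq, sub_self, smul_zero]
  rw [smul_eq_zero_iff_right Complex.I_ne_zero, sub_eq_zero] at hskew
  exact hskew.symm

theorem cstarMatrix_nonneg_iff_matrixQuadForm_nonneg {M : CStarMatrix n n A} :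
    0 ≤ M ↔ ∀ b, 0 ≤ matrixQuadForm b M := by
  refine ⟨fun hM b => ?_, fun h => ?_⟩
  · obtain ⟨N, rfl⟩ := exists_eq_star_mul_self_of_nonneg hM
    rw [matrixQuadForm_star_mul_self]
    exact Finset.sum_nonneg fun k _ => star_mul_self_nonneg _
  · exact cstarMatrix_nonneg_of_isSelfAdjoint
      (cstarMatrix_isSelfAdjoint_of_matrixQuadForm fun b => (h b).isSelfAdjoint) h

variable {H : Type*} [NormedAddCommGroup H] [InnerProductSpace ℂ H]

lemma nonneg_iff_inner_nonneg {T : H →L[ℂ] H} : 0 ≤ T ↔ ∀ ξ, 0 ≤ ⟪ξ, T ξ⟫_ℂ := by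
  rw [ContinuousLinearMap.nonneg_iff_isPositive, ContinuousLinearMap.isPositive_iff_complex]
  refine forall_congr' fun ξ => ?_
  rw [← inner_conj_symm ξ, starRingEnd_apply, star_nonneg_iff, Complex.nonneg_iff, Complex.ext_iff]
  simp [and_comm]

theorem cstarMatrix_nonneg_iff_inner_nonneg [CompleteSpace H] {M : CStarMatrix n n (H →L[ℂ] H)} :
    0 ≤ M ↔ ∀ ξ : n → H, 0 ≤ ∑ i, ∑ j, ⟪ξ i, M i j (ξ j)⟫_ℂ := by
  constructor
  · intro hM ξ
    obtain ⟨N, rfl⟩ := exists_eq_star_mul_self_of_nonneg hM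
    have hN : ∑ i, ∑ j, ⟪ξ i, (star N * N) i j (ξ j)⟫_ℂ =
        ∑ k, ⟪∑ i, N k i (ξ i), ∑ i, N k i (ξ i)⟫_ℂ := by
      simp only [CStarMatrix.mul_apply, CStarMatrix.star_apply, inner_sum, sum_inner,
        _root_.sum_apply, mul_apply_eq_comp, ContinuousLinearMap.star_eq_adjoint,
        ContinuousLinearMap.adjoint_inner_right]
      rw [Finset.sum_comm_cycle]
      exact Finset.sum_congr rfl fun k _ => Finset.sum_comm
    rw [hN]
    refine Finset.sum_nonneg fun k _ => ?_
    rw [inner_self_eq_norm_sq_to_K, ← RCLike.ofReal_pow]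
    exact Complex.zero_le_real.mpr (sq_nonneg _)
  · intro h
    rw [cstarMatrix_nonneg_iff_matrixQuadForm_nonneg]
    intro b
    rw [nonneg_iff_inner_nonneg]
    intro η
    simpa only [matrixQuadForm_apply, _root_.sum_apply, inner_sum, mul_apply_eq_comp,
      ContinuousLinearMap.star_eq_adjoint, ContinuousLinearMap.adjoint_inner_right]
      using h fun i => b i η

end Positivity

namespace OperatorSystem

variable {A : Type u} [CStarAlgebra A] {S : OperatorSystem A}
  {H : Type v} [NormedAddCommGroup H] [InnerProductSpace ℂ H] [CompleteSpace H]

instance : One S.toSubmodule := ⟨⟨1, S.one_mem'⟩⟩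

@[simp] lemma coe_one : ((1 : S.toSubmodule) : A) = 1 := rfl

instance : StarAddMonoid S.toSubmodule where
  star x := ⟨star (x : A), S.star_mem' x.2⟩
  star_involutive _ := Subtype.ext (star_star _)
  star_add _ _ := Subtype.ext (star_add _ _)

@[simp] lemma coe_star (x : S.toSubmodule) : ((star x : S.toSubmodule) : A) = star (x : A) := rfl

instance : StarModule ℂ S.toSubmodule := ⟨fun c x => Subtype.ext (star_smul c (x : A))⟩

section CompletelyPositive

open scoped ComplexOrder

variable [PartialOrder A] [StarOrderedRing A]

theorem isCompletelyPositive_iff {φ : S.OpMap H} :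
    IsCompletelyPositive φ ↔ ∀ (n : ℕ) (M : Fin n → Fin n → S.toSubmodule),
      (∀ b : Fin n → A, 0 ≤ ∑ i, ∑ j, star (b i) * (M i j : A) * b j) →
        ∀ ξ : Fin n → H, 0 ≤ ∑ i, ∑ j, ⟪ξ i, φ (M i j) (ξ j)⟫_ℂ := by
  refine forall_congr' fun n => forall_congr' fun M => ?_
  rw [cstarMatrix_nonneg_iff_matrixQuadForm_nonneg, cstarMatrix_nonneg_iff_inner_nonneg]
  rfl

theorem IsCompletelyPositive.sum_inner_nonneg {φ : S.OpMap H} (hφ : IsCompletelyPositive φ)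
    {X : Type*} (s : Finset X) (M : X → X → S.toSubmodule)
    (hM : ∀ b : X → A, 0 ≤ ∑ x ∈ s, ∑ y ∈ s, star (b x) * (M x y : A) * b y) (ξ : X → H) :
    0 ≤ ∑ x ∈ s, ∑ y ∈ s, ⟪ξ x, φ (M x y) (ξ y)⟫_ℂ := by
  obtain ⟨n, g, rfl⟩ : ∃ (n : ℕ) (g : Fin n ↪ X), Finset.univ.map g = s :=
    ⟨_, s.equivFin.symm.toEmbedding.trans (Function.Embedding.subtype _), by
      rw [← Finset.map_map, Finset.map_univ_equiv, Finset.univ_eq_attach, Finset.attach_map_val]⟩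
  simp only [Finset.sum_map] at hM ⊢
  refine isCompletelyPositive_iff.mp hφ n (fun i j => M (g i) (g j)) (fun b => ?_) (ξ ∘ g)
  simpa only [g.injective.extend_apply] using hM (Function.extend g b 0)

lemma IsCompletelyPositive.map_nonneg {φ : S.OpMap H} (hφ : IsCompletelyPositive φ)
    {x : S.toSubmodule} (hx : 0 ≤ (x : A)) : 0 ≤ φ x :=
  nonneg_iff_inner_nonneg.mpr fun ξ => by
    simpa using hφ.sum_inner_nonneg Finset.univ (fun _ _ : Unit => x)
      (fun b => by simpa using star_left_conjugate_nonneg hx _) fun _ => ξ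

lemma IsCompletelyPositive.isSelfAdjoint_map {φ : S.OpMap H} (hφ : IsCompletelyPositive φ)
    {x : S.toSubmodule} (hx : IsSelfAdjoint x) : IsSelfAdjoint (φ x) := by
  have hshift : 0 ≤ ((x + (‖(x : A)‖ : ℂ) • 1 : S.toSubmodule) : A) := by
    have hxA : IsSelfAdjoint (x : A) := congrArg Subtype.val hx
    simpa [neg_le_iff_add_nonneg, Algebra.algebraMap_eq_smul_one]
      using hxA.neg_algebraMap_norm_le_self
  have hone : IsSelfAdjoint (φ 1) := (hφ.map_nonneg (x := 1) zero_le_one).isSelfAdjoint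
  have hsub : φ x = φ (x + (‖(x : A)‖ : ℂ) • 1) - (‖(x : A)‖ : ℂ) • φ 1 := by
    rw [map_add, map_smul, add_sub_cancel_right]
  rw [hsub]
  exact (hφ.map_nonneg hshift).isSelfAdjoint.sub (.smul (Complex.conj_ofReal _) hone)

lemma IsCompletelyPositive.map_star {φ : S.OpMap H} (hφ : IsCompletelyPositive φ)
    (x : S.toSubmodule) : φ (star x) = star (φ x) := by
  have hre := (hφ.isSelfAdjoint_map (realPart x).2).star_eq
  have him := (hφ.isSelfAdjoint_map (imaginaryPart x).2).star_eq
  rw [← realPart_add_I_smul_imaginaryPart x]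
  simp only [star_add, star_smul, map_add, map_smul, hre, him, (realPart x).2.star_eq,
    (imaginaryPart x).2.star_eq]

lemma IsUCP.apply_one {φ : S.OpMap H} (hφ : IsUCP φ) : φ 1 = 1 := hφ.map_one

end CompletelyPositive

end OperatorSystem

section Kernel

open UniformSpace (Completion)
open scoped ComplexOrder

variable {A : Type*} [CStarAlgebra A] {X : Type*}

/-- The quadratic form `∑ x y, (b x)⋆ k(x, y) (b y)` of a finitely supported `A`-valued kernel `k`
on `X`, as a linear function of the kernel. -/
noncomputable def kernelForm (b : X → A) : (X × X →₀ A) →ₗ[ℂ] A :=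
  Finsupp.lsum ℂ fun p => LinearMap.mulLeftRight ℂ (star (b p.1), b p.2)

@[simp] lemma kernelForm_single (b : X → A) (p : X × X) (a : A) :
    kernelForm b (Finsupp.single p a) = star (b p.1) * a * b p.2 := by
  simp [kernelForm]

lemma kernelForm_apply (b : X → A) (k : X × X →₀ A) :
    kernelForm b k = k.sum fun p a => star (b p.1) * a * b p.2 := by
  simp [kernelForm, Finsupp.lsum_apply, Finsupp.sum]

/-- The kernel `(x, y) ↦ (c x)⋆ (d y)`. -/
noncomputable def pairKernel (c d : X →₀ A) : X × X →₀ A :=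
  c.sum fun x a => d.sum fun y a' => Finsupp.single (x, y) (star a * a')

lemma kernelForm_pairKernel (b : X → A) (c d : X →₀ A) :
    kernelForm b (pairKernel c d) =
      star (Finsupp.linearCombination A b c) * Finsupp.linearCombination A b d := by
  simp only [pairKernel, Finsupp.linearCombination_apply, Finsupp.sum, map_sum, kernelForm_single,
    star_sum, star_mul, Finset.sum_mul_sum, mul_assoc, smul_eq_mul]

lemma pairKernel_single (x y : X) (a a' : A) :
    pairKernel (Finsupp.single x a) (Finsupp.single y a') =
      Finsupp.single (x, y) (star a * a') := by
  simp [pairKernel]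

variable [PartialOrder A] [StarOrderedRing A]

variable (A X) in
/-- The cone of kernels whose quadratic form has positive real part. -/
noncomputable def kernelCone : PointedCone ℝ (X × X →₀ A) where
  carrier := {k | ∀ b, 0 ≤ kernelForm b k + star (kernelForm b k)}
  add_mem' {k l} hk hl b := by
    rw [map_add, star_add, add_add_add_comm]
    exact add_nonneg (hk b) (hl b)
  zero_mem' b := by simp
  smul_mem' c k hk b := by
    have hsmul : c • k = ((c : ℝ) : ℂ) • k := by ext; simp
    rw [hsmul, map_smul, star_smul]
    simpa using smul_nonneg c.2 (hk b)

lemma exists_single_add_mem_kernelCone (p : X × X) (a : A) : ∃ r : ℂ,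
    Finsupp.single (p.1, p.1) 1 + Finsupp.single (p.2, p.2) (r • 1) + Finsupp.single p a ∈
      kernelCone A X := by
  refine ⟨(‖a‖ ^ 2 : ℝ), fun b => ?_⟩
  have hbound : star (a * b p.2) * (a * b p.2) ≤ ‖a‖ ^ 2 • (star (b p.2) * b p.2) := by
    rw [star_mul, ← mul_assoc, mul_assoc _ (star a), sq, ← CStarRing.norm_star_mul_self (x := a)]
    exact CStarAlgebra.star_left_conjugate_le_norm_smul
  have hpos : 0 ≤ star (b p.1) * b p.1 + (star (b p.1 + a * b p.2) * (b p.1 + a * b p.2) +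
      (‖a‖ ^ 2 • (star (b p.2) * b p.2) - star (a * b p.2) * (a * b p.2) +
        ‖a‖ ^ 2 • (star (b p.2) * b p.2))) :=
    add_nonneg (star_mul_self_nonneg _) <| add_nonneg (star_mul_self_nonneg _) <|
      add_nonneg (sub_nonneg.mpr hbound) <| smul_nonneg (by positivity) (star_mul_self_nonneg _)
  refine hpos.trans_eq ?_
  simp only [map_add, kernelForm_single, star_add, star_mul, star_star, star_smul, mul_smul_comm,
    smul_mul_assoc, mul_one, Complex.coe_smul, star_trivial, add_mul, mul_add, mul_assoc]
  abel

variable (A X) in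
/-- A linear functional on finitely supported kernels that is positive on the kernels with positive
quadratic form and compatible with the adjoint of quadratic forms. -/
structure KernelFunctional where
  /-- The underlying linear functional. -/
  toLin : (X × X →₀ A) →ₗ[ℂ] ℂ
  nonneg : ∀ k, (∀ b, 0 ≤ kernelForm b k) → 0 ≤ toLin k
  map_star : ∀ k l, (∀ b, kernelForm b l = star (kernelForm b k)) → toLin l = star (toLin k)

namespace KernelFunctional

lemma exists_of_real (g : (X × X →₀ A) →ₗ[ℝ] ℝ) (hg : ∀ k ∈ kernelCone A X, 0 ≤ g k) :
    ∃ G : KernelFunctional A X, ∀ k, G.toLin k = g k - Complex.I * g (Complex.I • k) := by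
  let G : (X × X →₀ A) →ₗ[ℂ] ℂ := Module.Dual.extendRCLike (𝕜 := ℂ) g
  have hG (k) : G k = g k - Complex.I * g (Complex.I • k) := by
    simp [G, Module.Dual.extendRCLike_apply]
  have eq_zero_of_skew (k) (hk : ∀ b, kernelForm b k + star (kernelForm b k) = 0) : g k = 0 := by
    have hneg := hg (-k) fun b => by rw [map_neg, star_neg, ← neg_add, hk b, neg_zero]
    rw [map_neg, neg_nonneg] at hneg
    exact le_antisymm hneg (hg k fun b => (hk b).ge)
  refine ⟨⟨G, fun k hk => ?_, fun k l hkl => ?_⟩, hG⟩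
  · have him : g (Complex.I • k) = 0 := eq_zero_of_skew _ fun b => by
      rw [map_smul, star_smul, (hk b).isSelfAdjoint.star_eq]
      simp
    rw [hG, him]
    simpa using hg k fun b => add_nonneg (hk b) (star_nonneg_iff.mpr (hk b))
  · have hre : g (k - l) = 0 := eq_zero_of_skew _ fun b => by
      rw [map_sub, hkl b]
      simp
    have him : g (Complex.I • (k + l)) = 0 := eq_zero_of_skew _ fun b => by
      rw [map_smul, map_add, hkl b]
      simp only [star_smul, star_add, star_star, Complex.star_def, Complex.conj_I, neg_smul,
        smul_add]
      abel
    rw [map_sub, sub_eq_zero] at hre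
    rw [smul_add, map_add, add_eq_zero_iff_eq_neg] at him
    simp [hG, hre, him, sub_eq_add_neg]

variable (G : KernelFunctional A X)

lemma mono {k l : X × X →₀ A} (h : ∀ b, kernelForm b k ≤ kernelForm b l) :
    G.toLin k ≤ G.toLin l := by
  rw [← sub_nonneg, ← map_sub]
  exact G.nonneg _ fun b => by rw [map_sub]; exact sub_nonneg.mpr (h b)

lemma congr {k l : X × X →₀ A} (h : ∀ b, kernelForm b k = kernelForm b l) :
    G.toLin k = G.toLin l :=
  le_antisymm (G.mono fun b => (h b).le) (G.mono fun b => (h b).ge)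

/-- The finitely supported functions `X → A` with the semi-inner product that a positive functional
on kernels defines; the analogue of `PositiveLinearMap.PreGNS`. -/
def PreGNS (_G : KernelFunctional A X) := X →₀ A

noncomputable instance : AddCommGroup G.PreGNS := inferInstanceAs (AddCommGroup (X →₀ A))
noncomputable instance : Module ℂ G.PreGNS := inferInstanceAs (Module ℂ (X →₀ A))
noncomputable instance : Module A G.PreGNS := inferInstanceAs (Module A (X →₀ A))
instance : IsScalarTower ℂ A G.PreGNS := inferInstanceAs (IsScalarTower ℂ A (X →₀ A))

/-- The identity map from the finitely supported functions to the pre-Hilbert space. -/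
noncomputable def toPreGNS : (X →₀ A) ≃ₗ[A] G.PreGNS := LinearEquiv.refl A _

/-- The semi-inner product `⟨c, d⟩ = G (c⋆ d)`. -/
noncomputable abbrev preInnerProductCore : PreInnerProductSpace.Core ℂ G.PreGNS where
  inner c d := G.toLin (pairKernel (G.toPreGNS.symm c) (G.toPreGNS.symm d))
  conj_inner_symm c d :=
    (G.map_star _ _ fun b => by simp only [kernelForm_pairKernel, star_mul, star_star]).symm
  re_inner_nonneg c := RCLike.nonneg_iff.mp
    (G.nonneg _ fun b => by rw [kernelForm_pairKernel]; exact star_mul_self_nonneg _) |>.1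
  add_left c d e := by
    rw [← map_add]
    exact G.congr fun b => by simp [kernelForm_pairKernel, add_mul]
  smul_left c d r := by
    have hsymm : G.toPreGNS.symm (r • c) = r • G.toPreGNS.symm c := rfl
    rw [hsymm]
    refine (G.congr fun b => ?_).trans (map_smul G.toLin (starRingEnd ℂ r) _)
    simp [kernelForm_pairKernel, LinearMap.map_smul_of_tower]

noncomputable instance : SeminormedAddCommGroup G.PreGNS :=
  InnerProductSpace.Core.toSeminormedAddCommGroup (c := G.preInnerProductCore)
noncomputable instance : InnerProductSpace ℂ G.PreGNS :=
  InnerProductSpace.ofCore G.preInnerProductCore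

lemma inner_def (c d : G.PreGNS) :
    ⟪c, d⟫_ℂ = G.toLin (pairKernel (G.toPreGNS.symm c) (G.toPreGNS.symm d)) := rfl

lemma inner_smul_left_eq (a : A) (c d : G.PreGNS) : ⟪a • c, d⟫_ℂ = ⟪c, star a • d⟫_ℂ :=
  G.congr fun b => by simp [kernelForm_pairKernel, mul_assoc]

lemma inner_smul_smul_self_le (a : A) (c : G.PreGNS) :
    ⟪a • c, a • c⟫_ℂ ≤ ((‖a‖ ^ 2 : ℝ) : ℂ) * ⟪c, c⟫_ℂ := by
  simp only [inner_def]
  rw [← smul_eq_mul, ← map_smul]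
  refine G.mono fun b => ?_
  rw [map_smul, map_smul, kernelForm_pairKernel, kernelForm_pairKernel, map_smul, smul_eq_mul,
    star_mul, ← mul_assoc, mul_assoc _ (star a), Complex.coe_smul, sq,
    ← CStarRing.norm_star_mul_self (x := a)]
  exact CStarAlgebra.star_left_conjugate_le_norm_smul

lemma norm_smul_le_mul (a : A) (c : G.PreGNS) : ‖a • c‖ ≤ ‖a‖ * ‖c‖ := by
  have h := G.inner_smul_smul_self_le a c
  simp only [inner_self_eq_norm_sq_to_K, RCLike.ofReal_eq_complex_ofReal] at h
  rw [← sq_le_sq₀ (by positivity) (by positivity), mul_pow]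
  exact_mod_cast h

/-- The action of an element of `A` on the Hilbert space completion. -/
noncomputable def gnsOp (a : A) : Completion G.PreGNS →L[ℂ] Completion G.PreGNS :=
  ((Algebra.lsmul ℂ ℂ G.PreGNS a).mkContinuous ‖a‖ (G.norm_smul_le_mul a)).completion

@[simp] lemma gnsOp_coe (a : A) (c : G.PreGNS) :
    G.gnsOp a c = ((a • c : G.PreGNS) : Completion G.PreGNS) :=
  ContinuousLinearMap.completion_apply_coe _ _

lemma gnsOp_ext {T T' : Completion G.PreGNS →L[ℂ] Completion G.PreGNS}
    (h : ∀ c : G.PreGNS, T c = T' c) : T = T' :=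
  DFunLike.coe_injective (Completion.ext T.continuous T'.continuous h)

/-- The representation of `A` on the completion of the pre-Hilbert space, by left multiplication. -/
noncomputable def gnsStarAlgHom :
    A →⋆ₐ[ℂ] (Completion G.PreGNS →L[ℂ] Completion G.PreGNS) where
  toFun := G.gnsOp
  map_one' := G.gnsOp_ext fun c => by simp
  map_mul' a a' := G.gnsOp_ext fun c => by simp [mul_smul]
  map_zero' := G.gnsOp_ext fun c => by simp [Completion.coe_zero]
  map_add' a a' := G.gnsOp_ext fun c => by simp [add_smul, Completion.coe_add]
  commutes' r := G.gnsOp_ext fun c => by simp [Algebra.algebraMap_eq_smul_one]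
  map_star' a := by
    refine (ContinuousLinearMap.eq_adjoint_iff _ _).mpr fun c d => ?_
    induction c, d using Completion.induction_on₂ with
    | hp => apply isClosed_eq <;> fun_prop
    | ih c d => simp [inner_smul_left_eq]

/-- The vector of the completion attached to a point of `X`. -/
noncomputable def vec (x : X) : Completion G.PreGNS := G.toPreGNS (Finsupp.single x 1)

lemma inner_vec (x y : X) (a : A) :
    ⟪G.vec x, G.gnsStarAlgHom a (G.vec y)⟫_ℂ = G.toLin (Finsupp.single (x, y) a) := by
  change ⟪G.vec x, G.gnsOp a (G.vec y)⟫_ℂ = _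
  simp [vec, inner_def, pairKernel_single]

end KernelFunctional

end Kernel

lemma exists_linearIsometry_of_inner {𝕜 E F : Type*} [RCLike 𝕜]
    [NormedAddCommGroup E] [InnerProductSpace 𝕜 E] [NormedAddCommGroup F] [InnerProductSpace 𝕜 F]
    (f : E → F) (hf : ∀ x y, ⟪f x, f y⟫_𝕜 = ⟪x, y⟫_𝕜) : ∃ V : E →ₗᵢ[𝕜] F, ∀ x, V x = f x := by
  have hadd (x y) : f (x + y) = f x + f y := by
    rw [← sub_eq_zero, ← inner_self_eq_zero (𝕜 := 𝕜)]
    simp only [inner_sub_left, inner_add_left, inner_sub_right, inner_add_right, hf]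
    ring
  have hsmul (c : 𝕜) (x) : f (c • x) = c • f x := by
    rw [← sub_eq_zero, ← inner_self_eq_zero (𝕜 := 𝕜)]
    simp only [inner_sub_left, inner_smul_left, inner_sub_right, inner_smul_right, hf]
    ring
  exact ⟨LinearMap.isometryOfInner ⟨⟨f, hadd⟩, hsmul⟩ hf, fun _ => rfl⟩

lemma finsupp_sum_eq_sum_sum_of_support_subset {X M E : Type*} [Zero M] [AddCommMonoid E]
    {k : X × X →₀ M} {s : Finset X} (hs : k.support ⊆ s ×ˢ s) (f : X × X → M → E)
    (hf : ∀ p, f p 0 = 0) : k.sum f = ∑ x ∈ s, ∑ y ∈ s, f (x, y) (k (x, y)) := by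
  rw [Finsupp.sum_of_support_subset _ hs _ fun p _ => hf p, Finset.sum_product]

lemma exists_finset_support_subset_product {X M : Type*} [Zero M] (k : X × X →₀ M) :
    ∃ s : Finset X, k.support ⊆ s ×ˢ s := by
  classical
  exact ⟨k.support.image Prod.fst ∪ k.support.image Prod.snd, Finset.subset_product.trans <|
    Finset.product_subset_product Finset.subset_union_left Finset.subset_union_right⟩

namespace OperatorSystem

section ArvesonStinespring

open scoped ComplexOrder

variable {A : Type u} [CStarAlgebra A] {S : OperatorSystem A}
  {H : Type v} [NormedAddCommGroup H] [InnerProductSpace ℂ H]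

variable (S) in
/-- The finitely supported kernels on `X` with values in the operator system `S`. -/
noncomputable def kernels (X : Type*) : Submodule ℂ (X × X →₀ A) :=
  Finsupp.submodule fun _ => S.toSubmodule

lemma mem_kernels {X : Type*} {k : X × X →₀ A} :
    k ∈ S.kernels X ↔ ∀ p, k p ∈ S.toSubmodule :=
  Finsupp.mem_submodule_iff _ _

lemma single_mem_kernels {X : Type*} (p : X × X) {a : A} (ha : a ∈ S.toSubmodule) :
    Finsupp.single p a ∈ S.kernels X := by
  classical
  refine mem_kernels.mpr fun q => ?_
  rw [Finsupp.single_apply]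
  split_ifs
  exacts [ha, S.toSubmodule.zero_mem]

/-- The functional `k ↦ ∑ ξ η, ⟪ξ, Φ(k(ξ, η)) η⟫` on kernels indexed by the vectors of `H`. -/
noncomputable def kernelPairing (Φ : A →ₗ[ℂ] H →L[ℂ] H) : (H × H →₀ A) →ₗ[ℂ] ℂ :=
  Finsupp.lsum ℂ fun p =>
    innerₛₗ ℂ p.1 ∘ₗ (ContinuousLinearMap.apply ℂ H p.2).toLinearMap ∘ₗ Φ

lemma kernelPairing_apply (Φ : A →ₗ[ℂ] H →L[ℂ] H) (k : H × H →₀ A) :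
    kernelPairing Φ k = k.sum fun p a => ⟪p.1, Φ a p.2⟫_ℂ := by
  simp [kernelPairing, Finsupp.lsum_apply, Finsupp.sum]

variable [PartialOrder A] [StarOrderedRing A]

variable (S) in
lemma exists_mem_kernels_add_mem_kernelCone {X : Type*} (k : X × X →₀ A) :
    ∃ l ∈ S.kernels X, l + k ∈ kernelCone A X := by
  induction k using Finsupp.induction_linear with
  | zero => exact ⟨0, zero_mem _, by simp⟩
  | add k k' hk hk' =>
    obtain ⟨l, hl, hlk⟩ := hk
    obtain ⟨l', hl', hlk'⟩ := hk'
    exact ⟨l + l', add_mem hl hl', add_add_add_comm l k l' k' ▸ add_mem hlk hlk'⟩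
  | single p a =>
    obtain ⟨r, hr⟩ := exists_single_add_mem_kernelCone p a
    exact ⟨_, add_mem (single_mem_kernels _ S.one_mem')
      (single_mem_kernels _ (S.toSubmodule.smul_mem r S.one_mem')), hr⟩

variable [CompleteSpace H]

lemma IsCompletelyPositive.re_kernelPairing_nonneg {φ : S.OpMap H} (hφ : IsCompletelyPositive φ)
    {Φ : A →ₗ[ℂ] H →L[ℂ] H} (hΦ : ∀ x : S.toSubmodule, Φ x = φ x) {k : H × H →₀ A}
    (hk : k ∈ S.kernels H) (hpos : k ∈ kernelCone A H) : 0 ≤ (kernelPairing Φ k).re := by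
  obtain ⟨s, hs⟩ := exists_finset_support_subset_product k
  let M (ξ η : H) : S.toSubmodule := ⟨k (ξ, η), mem_kernels.mp hk _⟩
  have hpairing : kernelPairing Φ k = ∑ ξ ∈ s, ∑ η ∈ s, ⟪ξ, φ (M ξ η) η⟫_ℂ := by
    rw [kernelPairing_apply, finsupp_sum_eq_sum_sum_of_support_subset hs _ (by simp)]
    simp only [← hΦ, M]
  have hsum : kernelPairing Φ k + star (kernelPairing Φ k) =
      ∑ ξ ∈ s, ∑ η ∈ s, ⟪ξ, φ (M ξ η + star (M η ξ)) η⟫_ℂ := by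
    simp only [← starRingEnd_apply, hpairing, map_sum, inner_conj_symm, map_add, hφ.map_star,
      _root_.add_apply, inner_add_right, ContinuousLinearMap.star_eq_adjoint,
      ContinuousLinearMap.adjoint_inner_right, Finset.sum_add_distrib]
    rw [Finset.sum_comm (f := fun ξ η => ⟪φ (M ξ η) η, ξ⟫_ℂ)]
  have hnonneg : 0 ≤ kernelPairing Φ k + star (kernelPairing Φ k) := by
    rw [hsum]
    refine hφ.sum_inner_nonneg s (fun ξ η => M ξ η + star (M η ξ)) (fun b => ?_) id
    refine (hpos b).trans_eq ?_
    rw [kernelForm_apply, finsupp_sum_eq_sum_sum_of_support_subset hs _ (by simp)]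
    simp only [Submodule.coe_add, coe_star, mul_add, add_mul, Finset.sum_add_distrib, star_sum,
      star_mul, star_star, mul_assoc, M]
    rw [Finset.sum_comm (f := fun ξ η => star (b η) * (star (k (ξ, η)) * b ξ))]
  have hre := (Complex.nonneg_iff.mp hnonneg).1
  rw [Complex.add_re, Complex.star_def, Complex.conj_re] at hre
  linarith

/- The M. Riesz extension theorem applies because every kernel becomes positive after a diagonal
kernel with values in `S` is added. -/
lemma IsCompletelyPositive.exists_kernelFunctional {φ : S.OpMap H} (hφ : IsCompletelyPositive φ) :
    ∃ G : KernelFunctional A H, ∀ (ξ η : H) (x : S.toSubmodule),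
      G.toLin (Finsupp.single (ξ, η) (x : A)) = ⟪ξ, φ x η⟫_ℂ := by
  obtain ⟨Φ, hΦ⟩ := LinearMap.exists_extend φ
  replace hΦ (x : S.toSubmodule) : Φ x = φ x := LinearMap.congr_fun hΦ x
  let f : (H × H →₀ A) →ₗ.[ℝ] ℝ :=
    (Complex.reLm ∘ₗ (kernelPairing Φ).restrictScalars ℝ).toPMap ((S.kernels H).restrictScalars ℝ)
  obtain ⟨g, hgf, hg⟩ := riesz_extension (kernelCone A H) f
    (fun k hk => hφ.re_kernelPairing_nonneg hΦ k.2 hk) fun k => by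
      obtain ⟨l, hl, hlk⟩ := S.exists_mem_kernels_add_mem_kernelCone k
      exact ⟨⟨l, hl⟩, hlk⟩
  obtain ⟨G, hG⟩ := KernelFunctional.exists_of_real g hg
  have hre (ξ η : H) (x : S.toSubmodule) :
      g (Finsupp.single (ξ, η) (x : A)) = (⟪ξ, φ x η⟫_ℂ).re := by
    have hsingle : kernelPairing Φ (Finsupp.single (ξ, η) (x : A)) = ⟪ξ, φ x η⟫_ℂ := by
      rw [kernelPairing_apply, Finsupp.sum_single_index (by simp), hΦ]
    exact (hgf ⟨_, single_mem_kernels _ x.2⟩).trans (congrArg Complex.re hsingle)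
  refine ⟨G, fun ξ η x => ?_⟩
  rw [hG, hre, Finsupp.smul_single, ← Submodule.coe_smul, hre]
  apply Complex.ext <;> simp

/-- The theorems of Arveson and Stinespring combined. -/
theorem IsUCP.exists_representation {φ : S.OpMap H} (hφ : IsUCP φ) :
    ∃ (K : Type (max u v)) (_ : NormedAddCommGroup K) (_ : InnerProductSpace ℂ K)
      (_ : CompleteSpace K) (π : A →⋆ₐ[ℂ] (K →L[ℂ] K)) (V : H →ₗᵢ[ℂ] K),
      ∀ (x : S.toSubmodule) (ξ η : H), ⟪V ξ, π (x : A) (V η)⟫_ℂ = ⟪ξ, φ x η⟫_ℂ := by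
  obtain ⟨G, hG⟩ := hφ.completelyPositive.exists_kernelFunctional
  obtain ⟨V, hV⟩ := exists_linearIsometry_of_inner (𝕜 := ℂ) G.vec fun ξ η => by
    simpa [hφ.apply_one] using (G.inner_vec ξ η 1).trans (hG ξ η 1)
  exact ⟨_, _, _, inferInstance, G.gnsStarAlgHom, V, fun x ξ η => by
    rw [hV, hV, G.inner_vec, hG]⟩

end ArvesonStinespring

end OperatorSystem

section Compression

open ContinuousLinearMap (adjoint)

variable {H : Type*} [NormedAddCommGroup H] [InnerProductSpace ℂ H] [CompleteSpace H]
  {K : Type*} [NormedAddCommGroup K] [InnerProductSpace ℂ K] [CompleteSpace K]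

/-- The map `X ↦ T* X T` on bounded operators; for an isometry `T`, the compression of operators
to the range of `T`. -/
noncomputable def compression (T : H →L[ℂ] K) : (K →L[ℂ] K) →ₗ[ℂ] (H →L[ℂ] H) where
  toFun X := adjoint T ∘L X ∘L T
  map_add' X Y := by ext; simp
  map_smul' c X := by ext; simp

lemma compression_apply_apply (T : H →L[ℂ] K) (X : K →L[ℂ] K) (ξ : H) :
    compression T X ξ = adjoint T (X (T ξ)) := rfl

lemma inner_compression (T : H →L[ℂ] K) (X : K →L[ℂ] K) (ξ η : H) :
    ⟪ξ, compression T X η⟫_ℂ = ⟪T ξ, X (T η)⟫_ℂ := by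
  rw [compression_apply_apply, ContinuousLinearMap.adjoint_inner_right]

variable (V : H →ₗᵢ[ℂ] K)

lemma adjoint_apply_linearIsometry (ξ : H) : adjoint V.toContinuousLinearMap (V ξ) = ξ :=
  DFunLike.congr_fun
    (V.toContinuousLinearMap.norm_map_iff_adjoint_comp_self.mp V.norm_map) ξ

lemma norm_adjoint_linearIsometry_apply_le (k : K) : ‖adjoint V.toContinuousLinearMap k‖ ≤ ‖k‖ := by
  have hnorm : ‖adjoint V.toContinuousLinearMap‖ ≤ 1 := by
    simpa using V.norm_toContinuousLinearMap_le
  simpa only [one_mul] using ContinuousLinearMap.le_of_opNorm_le _ hnorm k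

lemma linearIsometry_apply_adjoint_of_norm_le {k : K}
    (hk : ‖k‖ ≤ ‖adjoint V.toContinuousLinearMap k‖) :
    V (adjoint V.toContinuousLinearMap k) = k := by
  set p := adjoint V.toContinuousLinearMap k
  have hinner : ⟪V p, k⟫_ℂ = ⟪p, p⟫_ℂ :=
    (ContinuousLinearMap.adjoint_inner_right V.toContinuousLinearMap p k).symm
  have hsub := norm_sub_sq (𝕜 := ℂ) (V p) k
  rw [hinner, V.norm_map, inner_self_eq_norm_sq] at hsub
  rw [← sub_eq_zero, ← norm_eq_zero]
  exact sq_eq_zero_iff.mp (le_antisymm (by nlinarith [norm_nonneg k]) (sq_nonneg _))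

end Compression

section Separable

open TopologicalSpace (SeparableSpace)

lemma orthonormal_countable {𝕜 E ι : Type*} [RCLike 𝕜] [NormedAddCommGroup E]
    [InnerProductSpace 𝕜 E] [SeparableSpace E] {v : ι → E} (hv : Orthonormal 𝕜 v) :
    Countable ι := by
  refine Pairwise.countable_of_isOpen_disjoint (s := fun i => Metric.ball (v i) (1 / 2))
    (fun i j hij => Metric.ball_disjoint_ball ?_) (fun _ => Metric.isOpen_ball)
    fun i => ⟨v i, by simp⟩
  have hdist : dist (v i) (v j) ^ 2 = 2 := by
    rw [dist_eq_norm, norm_sub_sq (𝕜 := 𝕜), hv.1, hv.1, hv.2 hij]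
    norm_num
  nlinarith [dist_nonneg (x := v i) (y := v j)]

lemma exists_linearIsometryEquiv_of_separableSpace (K : Type w) [NormedAddCommGroup K]
    [InnerProductSpace ℂ K] [CompleteSpace K] [SeparableSpace K] :
    ∃ (L : Type v) (_ : NormedAddCommGroup L) (_ : InnerProductSpace ℂ L) (_ : CompleteSpace L),
      SeparableSpace L ∧ Nonempty (L ≃ₗᵢ[ℂ] K) := by
  obtain ⟨s, b, -⟩ := exists_hilbertBasis ℂ K
  have : Countable s := orthonormal_countable b.orthonormal
  let e := (equivShrink.{v} s).symm
  let b' : HilbertBasis (Shrink.{v} s) ℂ K := HilbertBasis.mk (b.orthonormal.comp e e.injective) (by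
    rw [e.surjective.range_comp, b.dense_span])
  exact ⟨_, _, _, inferInstance, b'.repr.surjective.denseRange.separableSpace b'.repr.continuous,
    ⟨b'.repr.symm⟩⟩

end Separable

namespace OperatorSystem

variable {A : Type u} [CStarAlgebra A] {S : OperatorSystem A}
  {H : Type*} [NormedAddCommGroup H] [InnerProductSpace ℂ H] [CompleteSpace H]
  {K : Type*} [NormedAddCommGroup K] [InnerProductSpace ℂ K] [CompleteSpace K]
  {L : Type*} [NormedAddCommGroup L] [InnerProductSpace ℂ L] [CompleteSpace L]

open ContinuousLinearMap (adjoint)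
open scoped ComplexOrder

/-- The map `x ↦ T* φ(x) T` on an operator system. -/
noncomputable def compress (T : H →L[ℂ] K) (φ : S.OpMap K) : S.OpMap H := compression T ∘ₗ φ

lemma inner_compress (T : H →L[ℂ] K) (φ : S.OpMap K) (x : S.toSubmodule) (ξ η : H) :
    ⟪ξ, compress T φ x η⟫_ℂ = ⟪T ξ, φ x (T η)⟫_ℂ :=
  inner_compression _ _ _ _

lemma isDilation_compress (V : H →ₗᵢ[ℂ] K) (φ : S.OpMap K) :
    IsDilation (compress V.toContinuousLinearMap φ) V φ :=
  fun _ => rfl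

section IsDilation

variable {φ : S.OpMap H} {V : H →ₗᵢ[ℂ] K} {ψ : S.OpMap K}

lemma isDilation_iff_eq_compress : IsDilation φ V ψ ↔ φ = compress V.toContinuousLinearMap ψ :=
  (LinearMap.ext_iff (f := φ) (g := compress V.toContinuousLinearMap ψ)).symm

lemma isDilation_iff :
    IsDilation φ V ψ ↔ ∀ x ξ η, ⟪V ξ, ψ x (V η)⟫_ℂ = ⟪ξ, φ x η⟫_ℂ := by
  rw [isDilation_iff_eq_compress]
  refine ⟨fun h x ξ η => by rw [h, inner_compress, LinearIsometry.coe_toContinuousLinearMap],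
    fun h => ?_⟩
  ext x η
  refine ext_inner_left ℂ fun ξ => ?_
  rw [inner_compress, LinearIsometry.coe_toContinuousLinearMap, h]

lemma IsDilation.inner_eq (h : IsDilation φ V ψ) (x ξ η) :
    ⟪V ξ, ψ x (V η)⟫_ℂ = ⟪ξ, φ x η⟫_ℂ :=
  isDilation_iff.mp h x ξ η

lemma IsDilation.apply_eq (h : IsDilation φ V ψ) (x ξ) :
    φ x ξ = adjoint V.toContinuousLinearMap (ψ x (V ξ)) :=
  DFunLike.congr_fun (h x) ξ

lemma IsDilation.refl (φ : S.OpMap H) : IsDilation φ LinearIsometry.id φ :=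
  isDilation_iff.mpr fun _ _ _ => rfl

lemma IsDilation.trans {W : K →ₗᵢ[ℂ] L} {χ : S.OpMap L} (h : IsDilation φ V ψ)
    (h' : IsDilation ψ W χ) : IsDilation φ (W.comp V) χ :=
  isDilation_iff.mpr fun x ξ η => (h'.inner_eq x (V ξ) (V η)).trans (h.inner_eq x ξ η)

lemma IsDilation.norm_le (h : IsDilation φ V ψ) (x ξ) : ‖φ x ξ‖ ≤ ‖ψ x (V ξ)‖ := by
  rw [h.apply_eq]
  exact norm_adjoint_linearIsometry_apply_le _ _

lemma IsDilation.apply_of_norm_le (h : IsDilation φ V ψ) {x ξ} (hle : ‖ψ x (V ξ)‖ ≤ ‖φ x ξ‖) :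
    ψ x (V ξ) = V (φ x ξ) := by
  rw [h.apply_eq] at hle ⊢
  exact (linearIsometry_apply_adjoint_of_norm_le V hle).symm

end IsDilation

/-- The restriction of a representation of the C⋆-algebra to the operator system. -/
noncomputable def ofRep (S : OperatorSystem A) (π : A →⋆ₐ[ℂ] (K →L[ℂ] K)) : S.OpMap K :=
  π.toAlgHom.toLinearMap ∘ₗ S.toSubmodule.subtype

variable [PartialOrder A] [StarOrderedRing A]

lemma IsCompletelyPositive.compress {φ : S.OpMap K} (hφ : IsCompletelyPositive φ)
    (T : H →L[ℂ] K) : IsCompletelyPositive (compress T φ) :=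
  isCompletelyPositive_iff.mpr fun n M hM ξ => by
    simpa only [inner_compress] using isCompletelyPositive_iff.mp hφ n M hM fun i => T (ξ i)

lemma IsDilation.isUCP {φ : S.OpMap H} {V : H →ₗᵢ[ℂ] K} {ψ : S.OpMap K}
    (h : IsDilation φ V ψ) (hψ : IsUCP ψ) : IsUCP φ where
  map_one := ContinuousLinearMap.ext fun ξ =>
    (h.apply_eq 1 ξ).trans <| by simp [hψ.apply_one, adjoint_apply_linearIsometry]
  completelyPositive := isDilation_iff_eq_compress.mp h ▸ hψ.completelyPositive.compress _

lemma isUCP_ofRep (π : A →⋆ₐ[ℂ] (K →L[ℂ] K)) : IsUCP (ofRep S π) where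
  map_one := map_one π
  completelyPositive n _ hM := CompletelyPositiveMapClass.map_cstarMatrix_nonneg' π n _ hM

/-- The completely positive map `a ↦ V* π(a) V`. -/
noncomputable def compressRep (π : A →⋆ₐ[ℂ] (K →L[ℂ] K)) (V : H →ₗᵢ[ℂ] K) :
    A →CP (H →L[ℂ] H) where
  toLinearMap := compression V.toContinuousLinearMap ∘ₗ π.toAlgHom.toLinearMap
  map_cstarMatrix_nonneg' n M hM := by
    have hπ : 0 ≤ M.map π := CompletelyPositiveMapClass.map_cstarMatrix_nonneg' π n M hM
    refine cstarMatrix_nonneg_iff_inner_nonneg.mpr fun ξ => ?_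
    exact (cstarMatrix_nonneg_iff_inner_nonneg.mp hπ fun i => V (ξ i)).trans_eq <|
      Finset.sum_congr rfl fun i _ => Finset.sum_congr rfl fun j _ =>
        (inner_compression V.toContinuousLinearMap (π (M i j)) (ξ i) (ξ j)).symm

lemma IsUCP.norm_apply_le {φ : S.OpMap H} (hφ : IsUCP φ) (x : S.toSubmodule) (ξ : H) :
    ‖φ x ξ‖ ≤ ‖x‖ * ‖ξ‖ := by
  obtain ⟨K, _, _, _, π, V, h⟩ := hφ.exists_representation
  have h' : IsDilation φ V (ofRep S π) := isDilation_iff.mpr h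
  calc ‖φ x ξ‖ ≤ ‖π (x : A) (V ξ)‖ := h'.norm_le x ξ
    _ ≤ ‖π (x : A)‖ * ‖V ξ‖ := ContinuousLinearMap.le_opNorm _ _
    _ ≤ ‖x‖ * ‖ξ‖ := by
      rw [V.norm_map]
      gcongr
      exact NonUnitalStarAlgHom.norm_apply_le π _

lemma IsUCP.opNorm_le {φ : S.OpMap H} (hφ : IsUCP φ) (x : S.toSubmodule) : ‖φ x‖ ≤ ‖x‖ :=
  ContinuousLinearMap.opNorm_le_bound _ (norm_nonneg _) (hφ.norm_apply_le x)

lemma IsUCP.continuous {φ : S.OpMap H} (hφ : IsUCP φ) : Continuous φ :=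
  (φ.mkContinuous 1 fun x => by simpa using hφ.opNorm_le x).continuous

end OperatorSystem

section HilbertLimit

open ContinuousLinearMap (adjoint)

variable {H : ℕ → Type v} [∀ n, NormedAddCommGroup (H n)] [∀ n, InnerProductSpace ℂ (H n)]
  [∀ n, CompleteSpace (H n)] (V : ∀ n, H n →ₗᵢ[ℂ] H (n + 1))

/- The orthogonal complement of the range of `V n` is sent to the coordinate `n + 1`. -/
lemma exists_linearIsometry_hilbertSum_succ (n : ℕ) (J : H n →ₗᵢ[ℂ] lp H 2)
    (hJ : ∀ ξ k, n < k → J ξ k = 0) :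
    ∃ J' : H (n + 1) →ₗᵢ[ℂ] lp H 2,
      (∀ ξ k, n + 1 < k → J' ξ k = 0) ∧ ∀ ξ, J' (V n ξ) = J ξ := by
  let P := adjoint (V n).toContinuousLinearMap
  have hP (x : H n) (y : H (n + 1)) : ⟪V n x, y⟫_ℂ = ⟪x, P y⟫_ℂ :=
    (ContinuousLinearMap.adjoint_inner_right (V n).toContinuousLinearMap x y).symm
  have hP' (x : H n) (y : H (n + 1)) : ⟪y, V n x⟫_ℂ = ⟪P y, x⟫_ℂ :=
    (ContinuousLinearMap.adjoint_inner_left (V n).toContinuousLinearMap x y).symm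
  have hPV (x : H n) : P (V n x) = x := adjoint_apply_linearIsometry (V n) x
  let f (ξ : H (n + 1)) : lp H 2 := J (P ξ) + lp.single 2 (n + 1) (ξ - V n (P ξ))
  obtain ⟨J', hJ'⟩ := exists_linearIsometry_of_inner (𝕜 := ℂ) f fun x y => by
    simp only [f, inner_add_left, inner_add_right, lp.inner_single_left, lp.inner_single_right,
      hJ _ _ (Nat.lt_succ_self n), J.inner_map_map, lp.single_apply_self, inner_sub_left,
      inner_sub_right, hP, hP', map_sub, map_zero, hPV, sub_self, inner_zero_left, inner_zero_right]
    ring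
  refine ⟨J', fun ξ k hk => ?_, fun ξ => ?_⟩
  · rw [hJ', lp.coeFn_add, Pi.add_apply, hJ _ _ (by lia), lp.single_apply_ne _ _ _ (by lia),
      add_zero]
  · simp [hJ', f, hPV]

lemma exists_compatible_linearIsometry_hilbertSum :
    ∃ J : ∀ n, H n →ₗᵢ[ℂ] lp H 2, ∀ n ξ, J (n + 1) (V n ξ) = J n ξ := by
  obtain ⟨J₀, hJ₀⟩ := exists_linearIsometry_of_inner (𝕜 := ℂ)
    (fun ξ : H 0 => (lp.single 2 0 ξ : lp H 2)) fun ξ η => by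
      rw [lp.inner_single_left, lp.single_apply_self]
  choose next hnext hcomp using exists_linearIsometry_hilbertSum_succ V
  let J : ∀ n, {J : H n →ₗᵢ[ℂ] lp H 2 // ∀ ξ k, n < k → J ξ k = 0} := fun n =>
    Nat.rec ⟨J₀, fun ξ k hk => by rw [hJ₀, lp.single_apply_ne _ _ _ hk.ne']⟩
      (fun n J => ⟨next n J.1 J.2, hnext n J.1 J.2⟩) n
  exact ⟨fun n => (J n).1, fun n => hcomp n (J n).1 (J n).2⟩

lemma exists_hilbert_limit :
    ∃ (K : Type v) (_ : NormedAddCommGroup K) (_ : InnerProductSpace ℂ K) (_ : CompleteSpace K)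
      (J : ∀ n, H n →ₗᵢ[ℂ] K), (∀ n ξ, J (n + 1) (V n ξ) = J n ξ) ∧
      Dense (⋃ n, Set.range (J n)) := by
  obtain ⟨J, hJ⟩ := exists_compatible_linearIsometry_hilbertSum V
  let R (n : ℕ) : Submodule ℂ (lp H 2) := LinearMap.range (J n).toLinearMap
  have hR : Monotone R := monotone_nat_of_le_succ fun n => by
    rintro _ ⟨ξ, rfl⟩
    exact ⟨V n ξ, hJ n ξ⟩
  let K := (⨆ n, R n).topologicalClosure
  have hmem (n) (ξ : H n) : J n ξ ∈ K :=
    Submodule.le_topologicalClosure _ (Submodule.mem_iSup_of_mem n ⟨ξ, rfl⟩)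
  let JK (n) : H n →ₗᵢ[ℂ] K := ⟨(J n).toLinearMap.codRestrict K (hmem n), (J n).norm_map⟩
  refine ⟨K, inferInstance, inferInstance,
    (Submodule.isClosed_topologicalClosure _).completeSpace_coe, JK,
    fun n ξ => Subtype.ext (hJ n ξ), ?_⟩
  have hK : (K : Set (lp H 2)) = closure (⋃ n, (R n : Set (lp H 2))) := by
    rw [Submodule.topologicalClosure_coe, Submodule.coe_iSup_of_directed _ hR.directed_le]
  rw [Subtype.dense_iff, Set.image_iUnion]
  refine hK.subset.trans <| closure_mono (Set.iUnion_mono fun n => ?_)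
  rintro _ ⟨ξ, rfl⟩
  exact ⟨JK n ξ, ⟨ξ, rfl⟩, rfl⟩

end HilbertLimit

lemma separableSpace_of_dense_iUnion_range {ι X : Type*} [Countable ι] [TopologicalSpace X]
    [TopologicalSpace.PseudoMetrizableSpace X] {Y : ι → Type*} [∀ i, TopologicalSpace (Y i)]
    [∀ i, TopologicalSpace.SeparableSpace (Y i)] {f : ∀ i, Y i → X}
    (hf : ∀ i, Continuous (f i)) (hd : Dense (⋃ i, Set.range (f i))) :
    TopologicalSpace.SeparableSpace X := by
  rw [← TopologicalSpace.isSeparable_univ_iff, ← hd.closure_eq]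
  exact (TopologicalSpace.IsSeparable.iUnion fun i =>
    TopologicalSpace.isSeparable_range (hf i)).closure

section WeakLimit

open ContinuousLinearMap (adjoint)
open Filter Topology

variable {K : Type*} [NormedAddCommGroup K] [InnerProductSpace ℂ K] {ι : Type*}

lemma norm_inner_apply_le {T : K →L[ℂ] K} {C : ℝ} (hT : ‖T‖ ≤ C) (ξ η : K) :
    ‖⟪ξ, T η⟫_ℂ‖ ≤ C * ‖ξ‖ * ‖η‖ :=
  calc ‖⟪ξ, T η⟫_ℂ‖ ≤ ‖ξ‖ * ‖T η‖ := norm_inner_le_norm _ _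
    _ ≤ ‖ξ‖ * (C * ‖η‖) := by gcongr; exact T.le_of_opNorm_le hT η
    _ = C * ‖ξ‖ * ‖η‖ := by ring

lemma norm_apply_le_of_tendsto_inner {l : Filter ι} [l.NeBot] {T : ι → K →L[ℂ] K} {C : ℝ}
    (hC : ∀ i, ‖T i‖ ≤ C) {η ζ : K}
    (h : ∀ ξ, Tendsto (fun i => ⟪ξ, T i η⟫_ℂ) l (𝓝 ⟪ξ, ζ⟫_ℂ)) : ‖ζ‖ ≤ C * ‖η‖ := by
  have hle : ‖⟪ζ, ζ⟫_ℂ‖ ≤ C * ‖ζ‖ * ‖η‖ :=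
    le_of_tendsto' (h ζ).norm fun i => norm_inner_apply_le (hC i) ζ η
  rw [inner_self_eq_norm_sq_to_K, norm_pow, RCLike.norm_ofReal, abs_norm] at hle
  rcases (norm_nonneg ζ).eq_or_lt with hζ | hζ
  · obtain ⟨i⟩ := l.nonempty_of_neBot
    exact hζ ▸ mul_nonneg ((norm_nonneg _).trans (hC i)) (norm_nonneg _)
  · nlinarith

variable [CompleteSpace K] (U : Ultrafilter ι)

lemma exists_tendsto_inner_ultrafilter {T : ι → K →L[ℂ] K} {C : ℝ} (hC : ∀ i, ‖T i‖ ≤ C) :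
    ∃ T' : K →L[ℂ] K, ∀ ξ η, Tendsto (fun i => ⟪ξ, T i η⟫_ℂ) U (𝓝 ⟪ξ, T' η⟫_ℂ) := by
  have hlim (ξ η : K) : ∃ l ∈ Metric.closedBall (0 : ℂ) (C * ‖ξ‖ * ‖η‖),
      Tendsto (fun i => ⟪ξ, T i η⟫_ℂ) U (𝓝 l) := by
    refine (isCompact_closedBall (0 : ℂ) (C * ‖ξ‖ * ‖η‖)).ultrafilter_le_nhds
      (U.map fun i => ⟪ξ, T i η⟫_ℂ) ?_
    rw [le_principal_iff, Ultrafilter.coe_map, Filter.mem_map]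
    exact Filter.univ_mem' fun i => mem_closedBall_zero_iff.mpr (norm_inner_apply_le (hC i) ξ η)
  choose l hl hT using hlim
  let B : K →ₗ⋆[ℂ] K →ₗ[ℂ] ℂ := LinearMap.mk₂'ₛₗ _ _ l
    (fun ξ ξ' η => tendsto_nhds_unique (hT _ _) (by
      simpa only [inner_add_left] using (hT ξ η).add (hT ξ' η)))
    (fun c ξ η => tendsto_nhds_unique (hT _ _) (by
      simpa only [inner_smul_left, smul_eq_mul] using (hT ξ η).const_mul (starRingEnd ℂ c)))
    (fun ξ η η' => tendsto_nhds_unique (hT _ _) (by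
      simpa only [map_add, inner_add_right] using (hT ξ η).add (hT ξ η')))
    (fun c ξ η => tendsto_nhds_unique (hT _ _) (by
      simpa only [map_smul, inner_smul_right, smul_eq_mul, RingHom.id_apply]
        using (hT ξ η).const_mul c))
  let B' : K →L⋆[ℂ] K →L[ℂ] ℂ := B.mkContinuous₂ C fun ξ η => mem_closedBall_zero_iff.mp (hl ξ η)
  refine ⟨adjoint (InnerProductSpace.continuousLinearMapOfBilin B'), fun ξ η => ?_⟩
  rw [ContinuousLinearMap.adjoint_inner_right, InnerProductSpace.continuousLinearMapOfBilin_apply]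
  exact hT ξ η

lemma exists_linearMap_tendsto_inner_ultrafilter {E : Type*} [AddCommGroup E] [Module ℂ E]
    {θ : ι → E →ₗ[ℂ] K →L[ℂ] K} {C : E → ℝ} (hC : ∀ x i, ‖θ i x‖ ≤ C x) :
    ∃ ψ : E →ₗ[ℂ] K →L[ℂ] K,
      ∀ x ξ η, Tendsto (fun i => ⟪ξ, θ i x η⟫_ℂ) U (𝓝 ⟪ξ, ψ x η⟫_ℂ) := by
  choose ψ hψ using fun x => exists_tendsto_inner_ultrafilter U (hC x)
  have heq_of_tendsto {x : E} {T : K →L[ℂ] K}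
      (h : ∀ ξ η, Tendsto (fun i => ⟪ξ, θ i x η⟫_ℂ) U (𝓝 ⟪ξ, T η⟫_ℂ)) : ψ x = T :=
    ContinuousLinearMap.ext fun η => ext_inner_left ℂ fun ξ =>
      tendsto_nhds_unique (hψ x ξ η) (h ξ η)
  refine ⟨⟨⟨ψ, fun x y => heq_of_tendsto fun ξ η => ?_⟩, fun c x => heq_of_tendsto fun ξ η => ?_⟩,
    hψ⟩
  · simpa only [map_add, _root_.add_apply, inner_add_right] using (hψ x ξ η).add (hψ y ξ η)
  · simpa only [map_smul, _root_.smul_apply, inner_smul_right, RingHom.id_apply]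
      using (hψ x ξ η).const_mul c

end WeakLimit

namespace OperatorSystem

open ContinuousLinearMap (adjoint)
open Filter Topology
open scoped ComplexOrder

variable {A : Type u} [CStarAlgebra A] {S : OperatorSystem A}

section DilationSequence

variable {H : ℕ → Type v} [∀ n, NormedAddCommGroup (H n)] [∀ n, InnerProductSpace ℂ (H n)]
  [∀ n, CompleteSpace (H n)] {V : ∀ n, H n →ₗᵢ[ℂ] H (n + 1)} {φ : ∀ n, S.OpMap (H n)}
  {K : Type*} [NormedAddCommGroup K] [InnerProductSpace ℂ K] {J : ∀ n, H n →ₗᵢ[ℂ] K}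

lemma exists_isDilation_of_le (hV : ∀ n, IsDilation (φ n) (V n) (φ (n + 1)))
    (hJ : ∀ n ξ, J (n + 1) (V n ξ) = J n ξ) {m n : ℕ} (hmn : m ≤ n) :
    ∃ W : H m →ₗᵢ[ℂ] H n, (∀ ξ, J n (W ξ) = J m ξ) ∧ IsDilation (φ m) W (φ n) := by
  induction n, hmn using Nat.le_induction with
  | base => exact ⟨LinearIsometry.id, fun _ => rfl, IsDilation.refl _⟩
  | succ n _ ih =>
    obtain ⟨W, hJW, hW⟩ := ih
    exact ⟨(V n).comp W, fun ξ => (hJ n (W ξ)).trans (hJW ξ), hW.trans (hV n)⟩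

variable [CompleteSpace K]

lemma inner_compress_adjoint_of_le (hV : ∀ n, IsDilation (φ n) (V n) (φ (n + 1)))
    (hJ : ∀ n ξ, J (n + 1) (V n ξ) = J n ξ) {m n : ℕ} (hmn : m ≤ n) (x : S.toSubmodule)
    (ξ η : H m) :
    ⟪J m ξ, compress (adjoint (J n).toContinuousLinearMap) (φ n) x (J m η)⟫_ℂ =
      ⟪ξ, φ m x η⟫_ℂ := by
  obtain ⟨W, hJW, hW⟩ := exists_isDilation_of_le hV hJ hmn
  rw [inner_compress, ← hJW, ← hJW, adjoint_apply_linearIsometry, adjoint_apply_linearIsometry,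
    hW.inner_eq]

end DilationSequence

variable [PartialOrder A] [StarOrderedRing A]

lemma IsCompletelyPositive.of_tendsto_inner {K : Type*} [NormedAddCommGroup K]
    [InnerProductSpace ℂ K] [CompleteSpace K] {ι : Type*} {l : Filter ι} [l.NeBot]
    {θ : ι → S.OpMap K} (hθ : ∀ i, IsCompletelyPositive (θ i)) {ψ : S.OpMap K}
    (h : ∀ x ξ η, Tendsto (fun i => ⟪ξ, θ i x η⟫_ℂ) l (𝓝 ⟪ξ, ψ x η⟫_ℂ)) :
    IsCompletelyPositive ψ := by
  refine isCompletelyPositive_iff.mpr fun n M hM ξ => ?_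
  have hlim := tendsto_finsetSum Finset.univ fun i _ => tendsto_finsetSum Finset.univ fun j _ =>
    h (M i j) (ξ i) (ξ j)
  exact ge_of_tendsto' hlim fun k => isCompletelyPositive_iff.mp (hθ k) n M hM ξ

lemma IsUCP.opNorm_compress_adjoint_le {H K : Type*} [NormedAddCommGroup H]
    [InnerProductSpace ℂ H] [CompleteSpace H] [NormedAddCommGroup K] [InnerProductSpace ℂ K]
    [CompleteSpace K] {φ : S.OpMap H} (hφ : IsUCP φ) (J : H →ₗᵢ[ℂ] K) (x : S.toSubmodule) :
    ‖compress (adjoint J.toContinuousLinearMap) φ x‖ ≤ ‖x‖ := by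
  refine ContinuousLinearMap.opNorm_le_bound _ (norm_nonneg _) fun ξ => ?_
  calc ‖compress (adjoint J.toContinuousLinearMap) φ x ξ‖
      = ‖φ x (adjoint J.toContinuousLinearMap ξ)‖ := by
        rw [compress, LinearMap.comp_apply, compression_apply_apply,
          ContinuousLinearMap.adjoint_adjoint, LinearIsometry.coe_toContinuousLinearMap, J.norm_map]
    _ ≤ ‖x‖ * ‖adjoint J.toContinuousLinearMap ξ‖ := hφ.norm_apply_le _ _
    _ ≤ ‖x‖ * ‖ξ‖ := by gcongr; exact norm_adjoint_linearIsometry_apply_le J ξ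

/- The limit is a weak limit of the maps `x ↦ J_n φ_n(x) J_n*` along an ultrafilter; on the dense
union of the ranges the matrix coefficients are eventually constant. -/
theorem exists_dilation_limit {H : ℕ → Type v} [∀ n, NormedAddCommGroup (H n)]
    [∀ n, InnerProductSpace ℂ (H n)] [∀ n, CompleteSpace (H n)]
    {V : ∀ n, H n →ₗᵢ[ℂ] H (n + 1)} {φ : ∀ n, S.OpMap (H n)} (hφ : ∀ n, IsUCP (φ n))
    (hV : ∀ n, IsDilation (φ n) (V n) (φ (n + 1))) :
    ∃ (K : Type v) (_ : NormedAddCommGroup K) (_ : InnerProductSpace ℂ K) (_ : CompleteSpace K)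
      (J : ∀ n, H n →ₗᵢ[ℂ] K) (ψ : S.OpMap K), IsUCP ψ ∧ (∀ n, IsDilation (φ n) (J n) ψ) ∧
      (∀ n ξ, J (n + 1) (V n ξ) = J n ξ) ∧ Dense (⋃ n, Set.range (J n)) := by
  obtain ⟨K, _, _, _, J, hJ, hd⟩ := exists_hilbert_limit V
  let θ (n : ℕ) : S.OpMap K := compress (adjoint (J n).toContinuousLinearMap) (φ n)
  have hθ (x n) : ‖θ n x‖ ≤ ‖x‖ := (hφ n).opNorm_compress_adjoint_le (J n) x
  obtain ⟨ψ, hψ⟩ := exists_linearMap_tendsto_inner_ultrafilter (Filter.hyperfilter ℕ) hθ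
  have hdil (m) : IsDilation (φ m) (J m) ψ := isDilation_iff.mpr fun x ξ η =>
    tendsto_nhds_unique (hψ x (J m ξ) (J m η)) <| tendsto_const_nhds.congr' <|
      Nat.hyperfilter_le_atTop <| (eventually_ge_atTop m).mono fun n hmn =>
        (inner_compress_adjoint_of_le hV hJ hmn x ξ η).symm
  have hnorm_one : ‖(1 : S.toSubmodule)‖ ≤ 1 := IsStarProjection.norm_le (1 : A) (.one A)
  have hone (m) (ξ : H m) : ψ 1 (J m ξ) = J m ξ := by
    have hle : ‖ψ 1 (J m ξ)‖ ≤ 1 * ‖J m ξ‖ :=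
      norm_apply_le_of_tendsto_inner (fun n => (hθ 1 n).trans hnorm_one) (hψ 1 · (J m ξ))
    rw [one_mul, (J m).norm_map] at hle
    have hφ_one : φ m 1 ξ = ξ := by rw [(hφ m).apply_one, one_apply_eq_self]
    rw [(hdil m).apply_of_norm_le (hle.trans_eq (congrArg _ hφ_one.symm)), hφ_one]
  refine ⟨K, _, _, _, J, ψ, ⟨?_, ?_⟩, hdil, hJ, hd⟩
  · refine ContinuousLinearMap.coeFn_injective
      (Continuous.ext_on hd (ContinuousLinearMap.continuous _) continuous_id ?_)
    rintro _ ⟨_, ⟨m, rfl⟩, ξ, rfl⟩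
    exact hone m ξ
  · exact .of_tendsto_inner (fun n => (hφ n).completelyPositive.compress _) hψ

end OperatorSystem

section Stationary

/- This is the Brezis–Browder ordering principle. -/
lemma exists_forall_ge_eq {α : Type*} [Preorder α]
    (hα : ∀ u : ℕ → α, Monotone u → BddAbove (Set.range u)) {f : α → ℝ} (hf : Monotone f)
    (hb : BddAbove (Set.range f)) (a : α) : ∃ b ≥ a, ∀ c ≥ b, f c = f b := by
  have hstep (n : ℕ) (x : α) : ∃ y ≥ x, ∀ z ≥ y, f z ≤ f y + 1 / (n + 1 : ℝ) := by
    have hbx : BddAbove (f '' Set.Ici x) := hb.mono (Set.image_subset_range _ _)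
    obtain ⟨_, ⟨y, hxy, rfl⟩, hy⟩ := exists_lt_of_lt_csSup (Set.nonempty_Ici.image f)
      (sub_lt_self (sSup (f '' Set.Ici x)) (Nat.one_div_pos_of_nat (α := ℝ) (n := n)))
    exact ⟨y, hxy, fun z hz => (le_csSup hbx ⟨z, hxy.trans hz, rfl⟩).trans
      (sub_lt_iff_lt_add.mp hy).le⟩
  choose next hle hnext using hstep
  let u : ℕ → α := fun n => Nat.rec a next n
  have hu : Monotone u := monotone_nat_of_le_succ fun n => hle n (u n)
  obtain ⟨b, hub⟩ := hα u hu
  replace hub (n) : u n ≤ b := hub ⟨n, rfl⟩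
  refine ⟨b, hub 0, fun c hc => (hf hc).antisymm' <| le_of_forall_pos_le_add fun ε hε => ?_⟩
  obtain ⟨n, hn⟩ := exists_nat_one_div_lt hε
  linarith [hnext n (u n) c ((hub (n + 1)).trans hc), hf (hub (n + 1))]

lemma exists_forall_ge_forall_eq {α : Type*} [Preorder α]
    (hα : ∀ u : ℕ → α, Monotone u → BddAbove (Set.range u)) {f : ℕ → α → ℝ}
    (hf : ∀ k, Monotone (f k)) (hb : ∀ k, BddAbove (Set.range (f k))) (a : α) :
    ∃ b ≥ a, ∀ c ≥ b, ∀ k, f k c = f k b := by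
  choose next hle hnext using fun k => exists_forall_ge_eq hα (hf k) (hb k)
  let u : ℕ → α := fun n => Nat.rec a next n
  have hu : Monotone u := monotone_nat_of_le_succ fun n => hle n (u n)
  obtain ⟨b, hub⟩ := hα u hu
  replace hub (n) : u n ≤ b := hub ⟨n, rfl⟩
  exact ⟨b, hub 0, fun c hc k => (hnext k (u k) c ((hub (k + 1)).trans hc)).trans
    (hnext k (u k) b (hub (k + 1))).symm⟩

end Stationary

namespace OperatorSystem

open TopologicalSpace (SeparableSpace)

variable {A : Type u} [CStarAlgebra A] [PartialOrder A] [StarOrderedRing A] {S : OperatorSystem A}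
  {H : Type v} [NormedAddCommGroup H] [InnerProductSpace ℂ H] [CompleteSpace H]

/-- A unital completely positive dilation of `φ` that acts on a separable Hilbert space. -/
structure SeparableDilation (φ : S.OpMap H) where
  /-- The Hilbert space on which the dilation acts. -/
  space : Type v
  [normedAddCommGroup : NormedAddCommGroup space]
  [innerProductSpace : InnerProductSpace ℂ space]
  [completeSpace : CompleteSpace space]
  [separableSpace : SeparableSpace space]
  /-- The embedding of the original Hilbert space. -/
  emb : H →ₗᵢ[ℂ] space
  /-- The dilated map. -/
  map : S.OpMap space
  isUCP : IsUCP map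
  isDilation : IsDilation φ emb map

namespace SeparableDilation

attribute [instance] normedAddCommGroup innerProductSpace completeSpace separableSpace

/-- A unital completely positive map on a separable Hilbert space, as a dilation of itself. -/
def refl [SeparableSpace H] {φ : S.OpMap H} (hφ : IsUCP φ) : SeparableDilation φ :=
  ⟨H, LinearIsometry.id, φ, hφ, IsDilation.refl φ⟩

variable {φ : S.OpMap H}

/-- A dilation of a dilate of `φ`, as a dilation of `φ`. -/
def precomp {K : Type v} [NormedAddCommGroup K] [InnerProductSpace ℂ K] [CompleteSpace K]
    {ψ : S.OpMap K} (E : SeparableDilation ψ) {V : H →ₗᵢ[ℂ] K} (hV : IsDilation φ V ψ) :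
    SeparableDilation φ :=
  ⟨E.space, E.emb.comp V, E.map, E.isUCP, hV.trans E.isDilation⟩

/-- Dilations of `φ` are preordered by the dilation relation relative to `H`. -/
instance : Preorder (SeparableDilation φ) where
  le D D' := ∃ V : D.space →ₗᵢ[ℂ] D'.space, IsDilation D.map V D'.map ∧
    ∀ ξ, V (D.emb ξ) = D'.emb ξ
  le_refl D := ⟨LinearIsometry.id, IsDilation.refl _, fun _ => rfl⟩
  le_trans := fun _ _ _ ⟨V, hV, hVemb⟩ ⟨W, hW, hWemb⟩ =>
    ⟨W.comp V, hV.trans hW, fun ξ => (congrArg W (hVemb ξ)).trans (hWemb ξ)⟩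

lemma le_precomp (D : SeparableDilation φ) (E : SeparableDilation D.map) :
    D ≤ E.precomp D.isDilation :=
  ⟨E.emb, E.isDilation, fun _ => rfl⟩

lemma monotone_norm_map_emb (x : S.toSubmodule) (ξ : H) :
    Monotone fun D : SeparableDilation φ => ‖D.map x (D.emb ξ)‖ := by
  rintro D D' ⟨V, hV, hemb⟩
  simpa only [hemb] using hV.norm_le x (D.emb ξ)

lemma norm_map_emb_le (D : SeparableDilation φ) (x : S.toSubmodule) (ξ : H) :
    ‖D.map x (D.emb ξ)‖ ≤ ‖x‖ * ‖ξ‖ := by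
  simpa only [D.emb.norm_map] using D.isUCP.norm_apply_le x (D.emb ξ)

lemma continuous_norm_map_emb (D : SeparableDilation φ) :
    Continuous fun p : S.toSubmodule × H => ‖D.map p.1 (D.emb p.2)‖ :=
  ((D.isUCP.continuous.comp continuous_fst).clm_apply
    (D.emb.continuous.comp continuous_snd)).norm

lemma exists_limit (D : ℕ → SeparableDilation φ)
    {V : ∀ n, (D n).space →ₗᵢ[ℂ] (D (n + 1)).space}
    (hV : ∀ n, IsDilation (D n).map (V n) (D (n + 1)).map)
    (hemb : ∀ n ξ, V n ((D n).emb ξ) = (D (n + 1)).emb ξ) :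
    ∃ (L : SeparableDilation φ) (J : ∀ n, (D n).space →ₗᵢ[ℂ] L.space),
      (∀ n, IsDilation (D n).map (J n) L.map) ∧ (∀ n ξ, J n ((D n).emb ξ) = L.emb ξ) ∧
      (∀ n ξ, J (n + 1) (V n ξ) = J n ξ) ∧ Dense (⋃ n, Set.range (J n)) := by
  obtain ⟨K, _, _, _, J, ψ, hψ, hdil, hJ, hd⟩ := exists_dilation_limit (fun n => (D n).isUCP) hV
  have : SeparableSpace K := separableSpace_of_dense_iUnion_range (fun n => (J n).continuous) hd
  refine ⟨⟨K, (J 0).comp (D 0).emb, ψ, hψ, (D 0).isDilation.trans (hdil 0)⟩, J, hdil,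
    fun n ξ => ?_, hJ, hd⟩
  induction n with
  | zero => rfl
  | succ n ih => rw [← hemb, hJ, ih]

lemma bddAbove_range_of_monotone {D : ℕ → SeparableDilation φ} (hD : Monotone D) :
    BddAbove (Set.range D) := by
  choose V hV hemb using fun n : ℕ => hD n.le_succ
  obtain ⟨L, J, hJ, hJemb, -⟩ := exists_limit D hV hemb
  exact ⟨L, Set.forall_mem_range.mpr fun n => ⟨J n, hJ n, hJemb n⟩⟩

variable [SeparableSpace S.toSubmodule] [SeparableSpace H]

lemma exists_norm_map_emb_stationary (hφ : IsUCP φ) : ∃ D : SeparableDilation φ,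
    ∀ D' ≥ D, ∀ x ξ, ‖D'.map x (D'.emb ξ)‖ = ‖D.map x (D.emb ξ)‖ := by
  let p := TopologicalSpace.denseSeq (S.toSubmodule × H)
  obtain ⟨D, -, hD⟩ := exists_forall_ge_forall_eq (fun _ => bddAbove_range_of_monotone)
    (fun k => monotone_norm_map_emb (φ := φ) (p k).1 (p k).2)
    (fun k => ⟨_, Set.forall_mem_range.mpr fun D => D.norm_map_emb_le (p k).1 (p k).2⟩) (refl hφ)
  exact ⟨D, fun D' hD' x ξ => congr_fun
    ((TopologicalSpace.denseRange_denseSeq (S.toSubmodule × H)).equalizer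
      D'.continuous_norm_map_emb D.continuous_norm_map_emb (funext (hD D' hD'))) (x, ξ)⟩

/- Each step makes the previous space stationary, so the limit is stationary on a dense set. -/
theorem exists_forall_map_emb_eq (hφ : IsUCP φ) : ∃ D : SeparableDilation φ,
    ∀ (E : SeparableDilation D.map) (x ξ), E.map x (E.emb ξ) = E.emb (D.map x ξ) := by
  choose next hnext using fun D : SeparableDilation φ => exists_norm_map_emb_stationary D.isUCP
  let D : ℕ → SeparableDilation φ := fun n =>
    Nat.rec (motive := fun _ => SeparableDilation φ) (refl hφ)
      (fun _ D => (next D).precomp D.isDilation) n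
  obtain ⟨L, J, hJ, -, hcomp, hd⟩ := exists_limit D (V := fun n => (next (D n)).emb)
    (fun n => (next (D n)).isDilation) fun _ _ => rfl
  refine ⟨L, fun E x k => E.isDilation.apply_of_norm_le ?_⟩
  have hclosed : IsClosed {k | ‖E.map x (E.emb k)‖ ≤ ‖L.map x k‖} :=
    isClosed_le ((E.map x).continuous.comp E.emb.continuous).norm (L.map x).continuous.norm
  refine hclosed.closure_subset_iff.mpr (Set.iUnion_subset fun n => ?_) (hd k)
  rintro _ ⟨ξ, rfl⟩
  let E' : SeparableDilation (next (D n)).map := E.precomp (hJ (n + 1))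
  have hE := hnext (D n) _ ((next (D n)).le_precomp E') x ξ
  rw [Set.mem_ofPred_eq, ← hcomp]
  exact hE.trans_le ((hJ (n + 1)).norm_le x ((next (D n)).emb ξ))

end SeparableDilation

end OperatorSystem

lemma exists_linearIsometry_comp_eq {H K L : Type*} [NormedAddCommGroup H]
    [InnerProductSpace ℂ H] [NormedAddCommGroup K] [InnerProductSpace ℂ K] [NormedAddCommGroup L]
    [InnerProductSpace ℂ L] {U : L →ₗᵢ[ℂ] K} {V : H →ₗᵢ[ℂ] K} (h : Set.range V ⊆ Set.range U) :
    ∃ W : H →ₗᵢ[ℂ] L, U.comp W = V := by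
  choose f hf using fun ξ => h ⟨ξ, rfl⟩
  obtain ⟨W, hW⟩ := exists_linearIsometry_of_inner (𝕜 := ℂ) f fun ξ η => by
    rw [← U.inner_map_map, hf, hf, V.inner_map_map]
  exact ⟨W, LinearIsometry.ext fun ξ => (congrArg U (hW ξ)).trans (hf ξ)⟩

lemma exists_linearIsometry_range_superset {K : Type w} [NormedAddCommGroup K]
    [InnerProductSpace ℂ K] [CompleteSpace K] {s : Set K} (hs : TopologicalSpace.IsSeparable s) :
    ∃ (L : Type v) (_ : NormedAddCommGroup L) (_ : InnerProductSpace ℂ L) (_ : CompleteSpace L)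
      (U : L →ₗᵢ[ℂ] K), TopologicalSpace.SeparableSpace L ∧ s ⊆ Set.range U := by
  let M : Submodule ℂ K := (Submodule.span ℂ s).topologicalClosure
  have : CompleteSpace M := (Submodule.isClosed_topologicalClosure _).completeSpace_coe
  have : TopologicalSpace.SeparableSpace M := hs.span.closure.separableSpace
  obtain ⟨L, _, _, _, hL, ⟨e⟩⟩ := exists_linearIsometryEquiv_of_separableSpace.{v} M
  refine ⟨L, _, _, inferInstance, M.subtypeₗᵢ.comp e.toLinearIsometry, hL, fun k hk => ?_⟩
  have hkM : k ∈ M := Submodule.le_topologicalClosure _ (Submodule.subset_span hk)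
  exact ⟨e.symm ⟨k, hkM⟩, congrArg Subtype.val (e.apply_symm_apply _)⟩

namespace OperatorSystem

open TopologicalSpace (SeparableSpace)

variable {A : Type u} [CStarAlgebra A] {S : OperatorSystem A}
  {H : Type v} [NormedAddCommGroup H] [InnerProductSpace ℂ H] [CompleteSpace H]
  {K : Type w} [NormedAddCommGroup K] [InnerProductSpace ℂ K] [CompleteSpace K]

lemma apply_compress_of_mem_range {T : H →ₗᵢ[ℂ] K} {ψ : S.OpMap K} {x : S.toSubmodule} {ξ : H}
    (h : ψ x (T ξ) ∈ Set.range T) : T (compress T.toContinuousLinearMap ψ x ξ) = ψ x (T ξ) := by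
  obtain ⟨η, hη⟩ := h
  rw [(isDilation_compress T ψ).apply_eq, ← hη, adjoint_apply_linearIsometry]

lemma IsDilation.of_comp {L : Type*} [NormedAddCommGroup L] [InnerProductSpace ℂ L]
    [CompleteSpace L] {φ : S.OpMap H} {W : H →ₗᵢ[ℂ] L} {U : L →ₗᵢ[ℂ] K} {ψ : S.OpMap K}
    (h : IsDilation φ (U.comp W) ψ) : IsDilation φ W (compress U.toContinuousLinearMap ψ) :=
  isDilation_iff.mpr fun x ξ η => (inner_compress _ _ _ _ _).trans (h.inner_eq x ξ η)

variable [PartialOrder A] [StarOrderedRing A]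

/-- Every unital completely positive dilation of `φ` leaves the space of `φ` invariant, that is, it
has `φ` as a direct summand. The dilations range over the Hilbert spaces in a fixed universe. -/
def HasOnlyTrivialDilations (φ : S.OpMap H) : Prop :=
  ∀ (K : Type w) [NormedAddCommGroup K] [InnerProductSpace ℂ K] [CompleteSpace K]
    (V : H →ₗᵢ[ℂ] K) (ψ : S.OpMap K), IsUCP ψ → IsDilation φ V ψ →
    ∀ x ξ, ψ x (V ξ) = V (φ x ξ)

lemma IsUCP.isSeparable_range_apply [SeparableSpace S.toSubmodule] {L : Type*}
    [NormedAddCommGroup L] [InnerProductSpace ℂ L] [SeparableSpace L] {ψ : S.OpMap K}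
    (hψ : IsUCP ψ) (V : L →ₗᵢ[ℂ] K) :
    TopologicalSpace.IsSeparable (Set.range fun p : S.toSubmodule × L => ψ p.1 (V p.2)) :=
  TopologicalSpace.isSeparable_range <|
    (hψ.continuous.comp continuous_fst).clm_apply (V.continuous.comp continuous_snd)

/- A dilation can be cut down to the separable subspace spanned by the vectors `ψ(x) V ξ`. -/
theorem hasOnlyTrivialDilations_of_separable [SeparableSpace S.toSubmodule] [SeparableSpace H]
    {φ : S.OpMap H}
    (hφ : ∀ (E : SeparableDilation φ) (x ξ), E.map x (E.emb ξ) = E.emb (φ x ξ)) :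
    HasOnlyTrivialDilations.{u, v, w} φ := by
  intro K _ _ _ V ψ hψ hdil x ξ
  obtain ⟨L, _, _, _, U, _, hU⟩ :=
    exists_linearIsometry_range_superset.{v} (hψ.isSeparable_range_apply V)
  replace hU (x ξ) : ψ x (V ξ) ∈ Set.range U := hU ⟨(x, ξ), rfl⟩
  obtain ⟨W, rfl⟩ := exists_linearIsometry_comp_eq (U := U) (V := V) <| by
    rintro _ ⟨ξ, rfl⟩
    simpa only [hψ.apply_one, one_apply_eq_self] using hU 1 ξ
  let E : SeparableDilation φ :=
    ⟨L, W, compress U.toContinuousLinearMap ψ, (isDilation_compress U ψ).isUCP hψ, hdil.of_comp⟩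
  calc ψ x (U (W ξ)) = U (compress U.toContinuousLinearMap ψ x (W ξ)) :=
        (apply_compress_of_mem_range (hU x ξ)).symm
    _ = U (W (φ x ξ)) := congrArg U (hφ E x ξ)

end OperatorSystem

section RangeProjection

open ContinuousLinearMap (adjoint)

variable {H : Type*} [NormedAddCommGroup H] [InnerProductSpace ℂ H] [CompleteSpace H]
  {K : Type*} [NormedAddCommGroup K] [InnerProductSpace ℂ K] [CompleteSpace K]

/-- The orthogonal projection `V V*` onto the range of an isometry. -/
noncomputable def rangeProjection (V : H →ₗᵢ[ℂ] K) : K →L[ℂ] K :=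
  V.toContinuousLinearMap ∘L adjoint V.toContinuousLinearMap

variable {V : H →ₗᵢ[ℂ] K}

lemma rangeProjection_apply (k : K) :
    rangeProjection V k = V (adjoint V.toContinuousLinearMap k) := rfl

lemma rangeProjection_apply_linearIsometry (ξ : H) : rangeProjection V (V ξ) = V ξ := by
  rw [rangeProjection_apply, adjoint_apply_linearIsometry]

lemma star_rangeProjection : star (rangeProjection V) = rangeProjection V :=
  (ContinuousLinearMap.adjoint_comp _ _).trans <| by
    rw [ContinuousLinearMap.adjoint_adjoint, rangeProjection]

lemma mul_rangeProjection_of_apply_mem_range {X : K →L[ℂ] K}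
    (h : ∀ ξ, X (V ξ) ∈ Set.range V) :
    X * rangeProjection V = rangeProjection V * X * rangeProjection V := by
  ext k
  obtain ⟨η, hη⟩ := h (adjoint V.toContinuousLinearMap k)
  simp only [mul_apply_eq_comp, rangeProjection_apply, ← hη, adjoint_apply_linearIsometry]

lemma commute_rangeProjection {X : K →L[ℂ] K} (h : ∀ ξ, X (V ξ) ∈ Set.range V)
    (h' : ∀ ξ, star X (V ξ) ∈ Set.range V) : Commute X (rangeProjection V) := by
  have hstar := congrArg star (mul_rangeProjection_of_apply_mem_range h')
  simp only [star_mul, star_star, star_rangeProjection, ← mul_assoc] at hstar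
  exact (mul_rangeProjection_of_apply_mem_range h).trans hstar.symm

lemma apply_compression_of_commute {X : K →L[ℂ] K} (h : Commute X (rangeProjection V)) (ξ : H) :
    V (compression V.toContinuousLinearMap X ξ) = X (V ξ) :=
  calc V (compression V.toContinuousLinearMap X ξ) = (rangeProjection V * X) (V ξ) := rfl
    _ = X (rangeProjection V (V ξ)) := by rw [← h.eq, mul_apply_eq_comp]
    _ = X (V ξ) := by rw [rangeProjection_apply_linearIsometry]

lemma compression_one : compression V.toContinuousLinearMap 1 = 1 :=
  ContinuousLinearMap.ext fun ξ => adjoint_apply_linearIsometry V ξ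

lemma compression_star (T : H →L[ℂ] K) (X : K →L[ℂ] K) :
    compression T (star X) = star (compression T X) := by
  ext η
  refine ext_inner_left ℂ fun ξ => ?_
  rw [inner_compression, ContinuousLinearMap.star_eq_adjoint, ContinuousLinearMap.star_eq_adjoint,
    ContinuousLinearMap.adjoint_inner_right, ContinuousLinearMap.adjoint_inner_right,
    compression_apply_apply, ContinuousLinearMap.adjoint_inner_left]

lemma exists_starAlgHom_eq_compression {A : Type*} [Semiring A] [Algebra ℂ A] [Star A]
    {π : A →⋆ₐ[ℂ] (K →L[ℂ] K)} (h : ∀ a, Commute (π a) (rangeProjection V)) :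
    ∃ σ : A →⋆ₐ[ℂ] (H →L[ℂ] H), ∀ a, compression V.toContinuousLinearMap (π a) = σ a := by
  have hmul (a b : A) : compression V.toContinuousLinearMap (π (a * b)) =
      compression V.toContinuousLinearMap (π a) * compression V.toContinuousLinearMap (π b) := by
    ext ξ
    apply V.injective
    rw [mul_apply_eq_comp, apply_compression_of_commute (h _), apply_compression_of_commute (h _),
      apply_compression_of_commute (h _), map_mul, mul_apply_eq_comp]
  have hone : compression V.toContinuousLinearMap (π 1) = 1 := by rw [map_one, compression_one]
  let σ : A →ₐ[ℂ] (H →L[ℂ] H) :=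
    .ofLinearMap (compression V.toContinuousLinearMap ∘ₗ π.toAlgHom.toLinearMap) hone hmul
  exact ⟨{ σ with
    map_star' a := (congrArg _ (map_star π a)).trans (compression_star _ _) }, fun _ => rfl⟩

end RangeProjection

namespace OperatorSystem

section Generation

variable {A : Type*} [CStarAlgebra A] {S : OperatorSystem A}

lemma starSubalgebra_eq_top {B : StarSubalgebra ℂ A} (hB : IsClosed (B : Set A))
    (hS : ∀ x : S.toSubmodule, (x : A) ∈ B) : B = ⊤ :=
  top_le_iff.mp <| S.generates'.ge.trans <| StarSubalgebra.topologicalClosure_minimal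
    (StarAlgebra.adjoin_le fun a ha => hS ⟨a, ha⟩) hB

lemma starAlgHom_ext {B : Type*} [CStarAlgebra B] {σ τ : A →⋆ₐ[ℂ] B}
    (h : ∀ x : S.toSubmodule, σ (x : A) = τ x) : σ = τ := by
  have hclosed : IsClosed (StarAlgHom.equalizer σ τ : Set A) :=
    isClosed_eq (map_continuous σ) (map_continuous τ)
  ext a
  exact (starSubalgebra_eq_top hclosed h).ge (StarSubalgebra.mem_top (x := a))

lemma commute_rangeProjection_of_apply_mem_range
    {H : Type*} [NormedAddCommGroup H] [InnerProductSpace ℂ H] [CompleteSpace H]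
    {K : Type*} [NormedAddCommGroup K] [InnerProductSpace ℂ K] [CompleteSpace K]
    {π : A →⋆ₐ[ℂ] (K →L[ℂ] K)} {V : H →ₗᵢ[ℂ] K}
    (h : ∀ (x : S.toSubmodule) ξ, π (x : A) (V ξ) ∈ Set.range V) (a : A) :
    Commute (π a) (rangeProjection V) := by
  let B := (StarSubalgebra.centralizer ℂ {rangeProjection V}).comap π
  have hmem (a : A) : a ∈ B ↔ Commute (π a) (rangeProjection V) := by
    simp only [B, StarSubalgebra.mem_comap, StarSubalgebra.mem_centralizer_iff,
      Set.mem_singleton_iff, forall_eq, star_rangeProjection, and_self]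
    exact eq_comm
  have hclosed : IsClosed (B : Set A) :=
    (Set.isClosed_centralizer _).preimage (map_continuous π)
  have hB : B = ⊤ := starSubalgebra_eq_top (S := S) hclosed fun x =>
    (hmem _).mpr <| commute_rangeProjection (h x) fun ξ => by
      simpa only [map_star, coe_star] using h (star x) ξ
  exact (hmem a).mp (hB.ge StarSubalgebra.mem_top)

/-- The whole C⋆-algebra as an operator system. -/
noncomputable def whole (A : Type*) [CStarAlgebra A] : OperatorSystem A where
  toSubmodule := ⊤
  one_mem' := trivial
  star_mem' _ := trivial
  generates' := top_le_iff.mp <| le_trans (fun _ _ => StarAlgebra.subset_adjoin ℂ _ trivial)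
    (StarSubalgebra.le_topologicalClosure _)

end Generation

variable {A : Type u} [CStarAlgebra A] [PartialOrder A] [StarOrderedRing A] {S : OperatorSystem A}
  {H : Type v} [NormedAddCommGroup H] [InnerProductSpace ℂ H] [CompleteSpace H]

/-- **Arveson's extension theorem**, in dilated form. -/
theorem IsUCP.exists_isCPExtension_compressRep {φ : S.OpMap H} (hφ : IsUCP φ) :
    ∃ (K : Type (max u v)) (_ : NormedAddCommGroup K) (_ : InnerProductSpace ℂ K)
      (_ : CompleteSpace K) (π : A →⋆ₐ[ℂ] (K →L[ℂ] K)) (V : H →ₗᵢ[ℂ] K),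
      IsCPExtension φ (compressRep π V) := by
  obtain ⟨K, _, _, _, π, V, h⟩ := hφ.exists_representation
  have hdil : IsDilation φ V (ofRep S π) := isDilation_iff.mpr h
  exact ⟨K, _, _, _, π, V, fun x => (hdil x).symm⟩

/-- **Stinespring's dilation theorem** for unital maps. -/
theorem exists_eq_compressRep {ψ : A →CP (H →L[ℂ] H)} (hψ : ψ 1 = 1) :
    ∃ (K : Type (max u v)) (_ : NormedAddCommGroup K) (_ : InnerProductSpace ℂ K)
      (_ : CompleteSpace K) (π : A →⋆ₐ[ℂ] (K →L[ℂ] K)) (V : H →ₗᵢ[ℂ] K),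
      ψ = compressRep π V := by
  let φ : (whole A).OpMap H := ψ.toLinearMap ∘ₗ (whole A).toSubmodule.subtype
  have hφ : IsUCP φ := ⟨hψ, fun n M hM => ψ.map_cstarMatrix_nonneg' n _ hM⟩
  obtain ⟨K, _, _, _, π, V, h⟩ := hφ.exists_isCPExtension_compressRep
  exact ⟨K, _, _, _, π, V, DFunLike.ext _ _ fun a => (h ⟨a, trivial⟩).symm⟩

lemma HasOnlyTrivialDilations.exists_starAlgHom {φ : S.OpMap H} (hφ : IsUCP φ)
    (h : HasOnlyTrivialDilations.{u, v, max u v} φ) {ψ : A →CP (H →L[ℂ] H)}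
    (hψ : IsCPExtension φ ψ) : ∃ σ : A →⋆ₐ[ℂ] (H →L[ℂ] H), ∀ a, ψ a = σ a := by
  obtain ⟨K, _, _, _, π, V, rfl⟩ := exists_eq_compressRep ((hψ 1).trans hφ.apply_one)
  have hdil : IsDilation φ V (ofRep S π) := fun x => (hψ x).symm
  exact exists_starAlgHom_eq_compression <| commute_rangeProjection_of_apply_mem_range (S := S)
    fun x ξ => ⟨φ x ξ, (h K V (ofRep S π) (isUCP_ofRep π) hdil x ξ).symm⟩

theorem HasOnlyTrivialDilations.hasUniqueExtensionProperty {φ : S.OpMap H} (hφ : IsUCP φ)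
    (h : HasOnlyTrivialDilations.{u, v, max u v} φ) : HasUniqueExtensionProperty φ := by
  refine ⟨?_, fun _ => h.exists_starAlgHom hφ⟩
  obtain ⟨K, _, _, _, π, V, hext⟩ := hφ.exists_isCPExtension_compressRep
  refine ⟨compressRep π V, hext, fun ψ hψ => DFunLike.ext _ _ fun a => ?_⟩
  obtain ⟨σ, hσ⟩ := h.exists_starAlgHom hφ hext
  obtain ⟨τ, hτ⟩ := h.exists_starAlgHom hφ hψ
  have hτσ : τ = σ := starAlgHom_ext (S := S) fun x => by rw [← hτ, hψ, ← hext, hσ]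
  rw [hτ, hσ, hτσ]

lemma IsUCP.apply_mem_orthogonal {φ : S.OpMap H} (hφ : IsUCP φ) {N : Submodule ℂ H}
    (hN : ∀ x, ∀ ξ ∈ N, φ x ξ ∈ N) (x : S.toSubmodule) {η : H} (hη : η ∈ Nᗮ) : φ x η ∈ Nᗮ := by
  intro ξ hξ
  have hadj : φ x = ContinuousLinearMap.adjoint (φ (star x)) := by
    rw [← ContinuousLinearMap.star_eq_adjoint, ← hφ.completelyPositive.map_star, star_star]
  rw [hadj, ContinuousLinearMap.adjoint_inner_right]
  exact hη _ (hN (star x) ξ hξ)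

theorem HasOnlyTrivialDilations.isMaximal {φ : S.OpMap H}
    (h : HasOnlyTrivialDilations.{u, v, w} φ) : IsMaximal.{u, v, w} φ := by
  intro K _ _ _ V ψ hψ hdil
  let M := LinearMap.range V.toLinearMap
  have hM (x) : ∀ k ∈ M, ψ x k ∈ M := by
    rintro _ ⟨ξ, rfl⟩
    exact ⟨φ x ξ, (h K V ψ hψ hdil x ξ).symm⟩
  refine ⟨compress Mᗮ.subtypeₗᵢ.toContinuousLinearMap ψ, (isDilation_compress _ ψ).isUCP hψ,
    fun x ξ η => ?_⟩
  have hη : ψ x (η : K) ∈ Set.range Mᗮ.subtypeₗᵢ :=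
    ⟨⟨ψ x η, hψ.apply_mem_orthogonal hM x η.2⟩, rfl⟩
  rw [map_add, h K V ψ hψ hdil]
  exact congrArg _ (apply_compress_of_mem_range hη).symm

end OperatorSystem

theorem theorem2p4 {A : Type u} [CStarAlgebra A] [PartialOrder A] [StarOrderedRing A]
    (S : OperatorSystem A) [TopologicalSpace.SeparableSpace S.toSubmodule]
    {H₀ : Type v} [NormedAddCommGroup H₀] [InnerProductSpace ℂ H₀] [CompleteSpace H₀]
    [TopologicalSpace.SeparableSpace H₀]
    (φ₀ : S.OpMap H₀) (hφ₀ : OperatorSystem.IsUCP φ₀) :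
    ∃ (H : Type v) (_ : NormedAddCommGroup H) (_ : InnerProductSpace ℂ H) (_ : CompleteSpace H)
      (V : H₀ →ₗᵢ[ℂ] H) (φ : S.OpMap H),
      TopologicalSpace.SeparableSpace H ∧
      OperatorSystem.IsUCP φ ∧
      OperatorSystem.IsDilation φ₀ V φ ∧
      OperatorSystem.HasUniqueExtensionProperty φ ∧
      OperatorSystem.IsMaximal.{u, v, w} φ := by
  obtain ⟨D, hD⟩ := OperatorSystem.SeparableDilation.exists_forall_map_emb_eq hφ₀
  exact ⟨D.space, _, _, inferInstance, D.emb, D.map, inferInstance, D.isUCP, D.isDilation,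
    (OperatorSystem.hasOnlyTrivialDilations_of_separable hD).hasUniqueExtensionProperty D.isUCP,
    (OperatorSystem.hasOnlyTrivialDilations_of_separable hD).isMaximal⟩
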